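/- Let $N\in\mathbb{N}$ and let $A_n,B_n\in GL_N(\mathbb{C})$ $(n\in\mathbb{Z})$ be bounded sequences in operator norm. On $\mathcal{K}=\ell^2(\mathbb{Z},\mathbb{C}^N)$ let $(S\psi)_n=A_n\psi_{n-1}+B_n\psi_n$, and on $\mathcal{H}=\mathcal{K}\oplus\mathcal{K}$ let $$H=\begin{pmatrix}0&S^*\\S&0\end{pmatrix},\qquad \Pi=\begin{pmatrix}1&0\\0&-1\end{pmatrix}.$$ For $a\in\mathbb{Z}$ let $\iota_a:\ell^2(\mathbb{Z}_a,\mathbb{C}^N)\to\mathcal{K}$, $\mathbb{Z}_a=(-\infty,a]\cap\mathbb{Z}$, be extension by zero, $S_a=\iota_a^*S\iota_a$ and $H_a=\begin{pmatrix}0&S_a^*\\S_a&0\end{pmatrix}$; on $\ell^2(\mathbb{Z}_a,\mathbb{C}^N)\oplus\ell^2(\mathbb{Z}_a,\mathbb{C}^N)$ the symbol $\Pi$ denotes the same block matrix. Let $P=\chi_{(-\infty,0)}(H)$ and $P_a=\chi_{(-\infty,0)}(H_a)$ be the Fermi projections, $P_{0,a}=\chi_{\{0\}}(H_a)$ and $\Sigma=\operatorname{sgn}H$.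 For an operator $T$ write $T(n,n'):\mathbb{C}^{2N}\to\mathbb{C}^{2N}$ for its matrix element between the positions $n'$ and $n$, and let $\|\cdot\|_1$ be the trace norm. Let $\Lambda:\mathbb{Z}\to\mathbb{R}$ be a switch function, i.e. $\Lambda(n)=1$ and $\Lambda(-n)=0$ for all sufficiently large $n>0$, acting on $\mathcal{H}$ by multiplication. Assume that 1. there are $\mu,\nu>0$ and $C<\infty$ such that $$\sum_{n,n'\in\mathbb{Z}}\|P(n,n')\|_1(1+|n|)^{-\nu}e^{\mu|n-n'|}\le C\quad\text{and}\quad \sum_{n,n'\in\mathbb{Z}_a}\|P_a(n,n')\|_1(1+|n|)^{-\nu}e^{\mu|n-n'|}\le C\quad\text{for all }a\in\mathbb{Z};$$ 2. $0$ is not an eigenvalue of $H$. Then $\Pi\Sigma[\Lambda,\Sigma]$ and, for every $a\in\mathbb{Z}$, $\Pi P_{0,a}$ are trace class, and the bulk index $\mathcal{N}=\frac12\operatorname{tr}(\Pi\Sigma[\Lambda,\Sigma])$ and the edge index $\mathcal{N}_a=\operatorname{tr}(\Pi P_{0,a})$ satisfy $$\mathcal{N}=\mathcal{N}_a\qquad\text{for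 every }a\in\mathbb{Z}.$$ In particular $\mathcal{N}$ is an integer. -/

import Mathlib

open MeasureTheory CompactlySupported
open scoped ENNReal InnerProductSpace

/-! On complex Hilbert spaces `⟪x, y⟫_ℂ` shall mean the inner product of `InnerProductSpace`. -/
attribute [local instance 2000] InnerProductSpace.toInner

noncomputable section

namespace ChiralDuality

variable {ℋ : Type*} [NormedAddCommGroup ℋ] [InnerProductSpace ℂ ℋ] [CompleteSpace ℋ]

/-- For a self-adjoint operator `T` and a vector `ψ`, the positive functional `g ↦ ⟪ψ, g(T) ψ⟫` on `C_c(ℝ)`,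
where `g(T)` is the continuous functional calculus. -/
def spectralFunctional (T : ℋ →L[ℂ] ℋ) (ψ : ℋ) : C_c(ℝ, ℝ) →ₚ[ℝ] ℝ :=
  PositiveLinearMap.mk₀
    { toFun := fun g => (⟪ψ, cfc (fun x : ℝ => g x) T ψ⟫_ℂ).re
      map_add' := fun f g => by
        have : cfc (fun x : ℝ => (f + g) x) T = cfc (fun x : ℝ => f x) T + cfc (fun x : ℝ => g x) T :=
          cfc_add T (fun x : ℝ => f x) (fun x : ℝ => g x)
        rw [this]
        simp [inner_add_right]
      map_smul' := fun c g => by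
        have : cfc (fun x : ℝ => (c • g) x) T = c • cfc (fun x : ℝ => g x) T :=
          cfc_smul c (fun x : ℝ => g x) T
        rw [this, smul_apply, ← Complex.coe_smul, inner_smul_right]
        simp }
    (fun g hg => by
      have h := cfc_nonneg (a := T) (f := fun x : ℝ => g x) (fun x _ => hg x)
      rw [ContinuousLinearMap.nonneg_iff_isPositive] at h
      exact (h.inner_nonneg_right ψ |> fun h => (Complex.le_def.1 h).1))

/-- The spectral measure of the self-adjoint operator `T` in the vector `ψ`: the measure on `ℝ` with
`∫ g dμ = ⟪ψ, g(T) ψ⟫` for all `g ∈ C_c(ℝ)` (Riesz, Markov, Kakutani). -/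
def spectralMeasure (T : ℋ →L[ℂ] ℋ) (ψ : ℋ) : Measure ℝ :=
  RealRMK.rieszMeasure (spectralFunctional T ψ)

theorem integral_spectralMeasure (T : ℋ →L[ℂ] ℋ) (ψ : ℋ) (g : C_c(ℝ, ℝ)) :
    ∫ x, g x ∂(spectralMeasure T ψ) = (⟪ψ, cfc (fun x : ℝ => g x) T ψ⟫_ℂ).re :=
  RealRMK.integral_rieszMeasure _ g

instance (T : ℋ →L[ℂ] ℋ) (ψ : ℋ) : (spectralMeasure T ψ).Regular :=
  RealRMK.regular_rieszMeasure _

theorem spectralMeasure_univ_le (T : ℋ →L[ℂ] ℋ) (ψ : ℋ) :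
    spectralMeasure T ψ Set.univ ≤ ENNReal.ofReal (‖ψ‖ ^ 2) := by
  rw [(isOpen_univ).measure_eq_iSup_isCompact]
  refine iSup₂_le fun K _ => iSup_le fun hK => ?_
  obtain ⟨f, h1, -, h3, h4⟩ := exists_continuous_one_zero_of_isCompact hK isClosed_empty
    (Set.disjoint_empty K)
  refine (RealRMK.rieszMeasure_le_of_eq_one (spectralFunctional T ψ) (f := ⟨f, h3⟩)
    (fun x => (h4 x).1) hK (fun x hx => h1 hx)).trans (ENNReal.ofReal_le_ofReal ?_)
  change (⟪ψ, cfc (fun x : ℝ => f x) T ψ⟫_ℂ).re ≤ _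
  have hle : ‖cfc (fun x : ℝ => f x) T‖ ≤ 1 := norm_cfc_le zero_le_one fun x _ => by
    rw [Real.norm_of_nonneg (h4 x).1]; exact (h4 x).2
  calc _ ≤ ‖⟪ψ, cfc (fun x : ℝ => f x) T ψ⟫_ℂ‖ := Complex.re_le_norm _
    _ ≤ ‖ψ‖ * (‖cfc (fun x : ℝ => f x) T‖ * ‖ψ‖) := (norm_inner_le_norm _ _).trans (by
        gcongr; exact ContinuousLinearMap.le_opNorm _ _)
    _ ≤ ‖ψ‖ * (1 * ‖ψ‖) := by gcongr
    _ = ‖ψ‖ ^ 2 := by ring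

instance (T : ℋ →L[ℂ] ℋ) (ψ : ℋ) : IsFiniteMeasure (spectralMeasure T ψ) :=
  ⟨(spectralMeasure_univ_le T ψ).trans_lt ENNReal.ofReal_lt_top⟩

/-- Linear relations (with nonnegative coefficients on either side) between diagonal matrix elements that hold
for every operator also hold for the integrals of bounded Borel functions. -/
theorem integral_spectralMeasure_identity (T : ℋ →L[ℂ] ℋ) {k l : ℕ}
    (a : Fin k → NNReal) (φ : Fin k → ℋ) (b : Fin l → NNReal) (χ : Fin l → ℋ)
    (h : ∀ R : ℋ →L[ℂ] ℋ, ∑ i, (a i : ℝ) * (⟪φ i, R (φ i)⟫_ℂ).re =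
      ∑ j, (b j : ℝ) * (⟪χ j, R (χ j)⟫_ℂ).re)
    {f : ℝ → ℝ} (hf : Measurable f) {C : ℝ} (hC : ∀ x, |f x| ≤ C) :
    ∑ i, (a i : ℝ) * ∫ x, f x ∂(spectralMeasure T (φ i)) =
      ∑ j, (b j : ℝ) * ∫ x, f x ∂(spectralMeasure T (χ j)) := by
  have key : ∀ {m : ℕ} (c : Fin m → NNReal) (ξ : Fin m → ℋ) (g : ℝ → ℝ) (_ : Measurable g) (D : ℝ)
      (_ : ∀ x, |g x| ≤ D), ∫ x, g x ∂(∑ i, c i • spectralMeasure T (ξ i)) =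
      ∑ i, (c i : ℝ) * ∫ x, g x ∂(spectralMeasure T (ξ i)) := by
    intro m c ξ g hg D hD
    rw [integral_finsetSum_measure]
    · refine Finset.sum_congr rfl fun i _ => ?_
      rw [integral_smul_nnreal_measure]; rfl
    · intro i _
      exact Integrable.of_bound hg.aestronglyMeasurable D (.of_forall hD)
  have hμ : ∑ i, a i • spectralMeasure T (φ i) = ∑ j, b j • spectralMeasure T (χ j) := by
    refine Measure.ext_of_integral_eq_on_compactlySupported fun g => ?_
    obtain ⟨D, hD⟩ := g.hasCompactSupport.exists_bound_of_continuous g.continuous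
    rw [key a φ g g.continuous.measurable D hD, key b χ g g.continuous.measurable D hD]
    simp only [integral_spectralMeasure]
    exact h _
  rw [← key a φ f hf C hC, ← key b χ f hf C hC, hμ]

/-- `F = f(T)` in the sense of the Borel functional calculus of the self-adjoint operator `T`:
`⟪ψ, F ψ⟫ = ∫ f dμ_ψ` for all `ψ`, with `μ_ψ` the spectral measure. There is exactly one such `F` for each bounded
Borel `f`, see `IsBorelCalculus.unique` and `exists_isBorelCalculus`. -/
def IsBorelCalculus (T : ℋ →L[ℂ] ℋ) (f : ℝ → ℝ) (F : ℋ →L[ℂ] ℋ) : Prop :=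
  ∀ ψ : ℋ, ⟪ψ, F ψ⟫_ℂ = ((∫ x, f x ∂(spectralMeasure T ψ) : ℝ) : ℂ)

theorem IsBorelCalculus.unique {T F G : ℋ →L[ℂ] ℋ} {f : ℝ → ℝ}
    (hF : IsBorelCalculus T f F) (hG : IsBorelCalculus T f G) : F = G := by
  have h : (F : ℋ →ₗ[ℂ] ℋ) = G := (ext_inner_map _ _).1 fun ψ => by
    have := (hF ψ).trans (hG ψ).symm
    rw [← inner_conj_symm]
    conv_rhs => rw [← inner_conj_symm]
    exact congrArg _ this
  exact ContinuousLinearMap.coe_injective h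

theorem exists_isBorelCalculus (T : ℋ →L[ℂ] ℋ) {f : ℝ → ℝ} (hf : Measurable f) {C : ℝ}
    (hC : ∀ x, |f x| ≤ C) : ∃ F : ℋ →L[ℂ] ℋ, IsBorelCalculus T f F := by
  set q : ℋ → ℝ := fun ψ => ∫ x, f x ∂(spectralMeasure T ψ) with hq
  have hqb : ∀ ψ, |q ψ| ≤ C * ‖ψ‖ ^ 2 := fun ψ => by
    have hC0 : 0 ≤ C := (abs_nonneg _).trans (hC 0)
    refine (norm_integral_le_of_norm_le_const (f := f) (C := C)
      (.of_forall fun x => by simpa using hC x)).trans ?_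
    gcongr
    exact ENNReal.toReal_le_of_le_ofReal (by positivity) (spectralMeasure_univ_le T ψ)
  have six : ∀ x y z, q (x + y + z) + q x + q y + q z = q (x + y) + q (y + z) + q (x + z) := by
    intro x y z
    have := integral_spectralMeasure_identity T ![1, 1, 1, 1] ![x + y + z, x, y, z]
      ![1, 1, 1] ![x + y, y + z, x + z] (fun R => by
        simp [Fin.sum_univ_succ, inner_add_left, inner_add_right]; ring) hf hC
    simpa [Fin.sum_univ_succ, add_assoc] using this
  have qsmul : ∀ (c : ℂ) x, q (c • x) = ‖c‖ ^ 2 * q x := by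
    intro c x
    have := integral_spectralMeasure_identity T ![1] ![c • x]
      ![‖c‖₊ ^ 2] ![x] (fun R => by
        simp [inner_smul_left, inner_smul_right, ← mul_assoc, Complex.mul_conj,
          ← Complex.normSq_eq_norm_sq, Complex.normSq_apply]) hf hC
    simpa using this
  have qreal : ∀ (c : ℝ) x y, 0 ≤ c →
      q ((c : ℂ) • x + y) + c * q (x - y) = q ((c : ℂ) • x - y) + c * q (x + y) := by
    intro c x y hc
    obtain ⟨d, hd⟩ : ∃ d : NNReal, (d : ℝ) = c := ⟨⟨c, hc⟩, rfl⟩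
    have := integral_spectralMeasure_identity T ![1, d] ![(c : ℂ) • x + y, x - y]
      ![1, d] ![(c : ℂ) • x - y, x + y] (fun R => by
        simp [Fin.sum_univ_succ, inner_add_left, inner_add_right, inner_sub_left, inner_sub_right,
          inner_smul_left, inner_smul_right, hd, -Complex.coe_smul]
        ring) hf hC
    simpa [Fin.sum_univ_succ, hd, -Complex.coe_smul] using this
  have q0 : q 0 = 0 := by simpa using qsmul 0 0
  have qneg : ∀ x, q (-x) = q x := fun x => by simpa using qsmul (-1) x
  set R : ℋ → ℋ → ℝ := fun φ ψ => (q (φ + ψ) - q (φ - ψ)) / 4 with hR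
  have Rcomm : ∀ φ ψ, R φ ψ = R ψ φ := fun φ ψ => by
    simp only [hR]
    rw [add_comm φ ψ, ← qneg (φ - ψ), neg_sub]
  have Radd : ∀ φ ψ₁ ψ₂, R φ (ψ₁ + ψ₂) = R φ ψ₁ + R φ ψ₂ := fun φ ψ₁ ψ₂ => by
    have h1 := six φ ψ₁ ψ₂
    have h2 := six φ (-ψ₁) (-ψ₂)
    rw [← neg_add, qneg, qneg, qneg, add_assoc φ, ← neg_add] at h2
    rw [add_assoc φ] at h1
    simp only [← sub_eq_add_neg] at h2
    simp only [hR]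
    linarith
  have Rneg : ∀ φ ψ, R (-φ) ψ = - R φ ψ := fun φ ψ => by
    simp only [hR]
    rw [show -φ + ψ = -(φ - ψ) by abel, show -φ - ψ = -(φ + ψ) by abel, qneg, qneg]
    ring
  have Rreal : ∀ (c : ℝ) φ ψ, R ((c : ℂ) • φ) ψ = c * R φ ψ := by
    intro c φ ψ
    rcases le_total 0 c with hc | hc
    · have := qreal c φ ψ hc
      simp only [hR]
      linarith
    · have := qreal (-c) (-φ) ψ (by linarith)
      rw [← neg_neg φ, Rneg (-φ)]
      simp only [Complex.ofReal_neg, neg_smul, smul_neg, neg_neg] at this ⊢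
      simp only [hR]
      linarith
  have RI : ∀ φ ψ, R (Complex.I • φ) ψ = - R φ (Complex.I • ψ) := by
    intro φ ψ
    rw [Rcomm φ, ← Rneg, Rcomm _ φ]
    have hψ : ψ = Complex.I • (-(Complex.I • ψ)) := by
      rw [smul_neg, smul_smul, Complex.I_mul_I, neg_smul, one_smul, neg_neg]
    conv_lhs => rw [hψ]
    simp only [hR]
    rw [← smul_add, ← smul_sub, qsmul, qsmul]
    simp
  have Rreal' : ∀ (c : ℝ) φ ψ, R φ ((c : ℂ) • ψ) = c * R φ ψ := fun c φ ψ => by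
    rw [Rcomm, Rreal, Rcomm]
  have Radd' : ∀ φ₁ φ₂ ψ, R (φ₁ + φ₂) ψ = R φ₁ ψ + R φ₂ ψ := fun φ₁ φ₂ ψ => by
    rw [Rcomm, Radd, Rcomm ψ, Rcomm ψ]
  have Rsmul : ∀ (c : ℂ) φ ψ, R (c • φ) ψ = R φ (starRingEnd ℂ c • ψ) := by
    intro c φ ψ
    have h1 : c • φ = (c.re : ℂ) • φ + (c.im : ℂ) • (Complex.I • φ) := by
      rw [smul_smul, ← add_smul, Complex.re_add_im]
    have h2 : starRingEnd ℂ c • ψ = (c.re : ℂ) • ψ + ((-c.im : ℝ) : ℂ) • (Complex.I • ψ) := by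
      rw [smul_smul, ← add_smul]
      congr 1
      apply Complex.ext <;> simp
    rw [h1, h2, Radd', Radd, Rreal, Rreal, Rreal', Rreal', RI]
    ring
  have Rb : ∀ φ ψ, |R φ ψ| ≤ C * (‖φ‖ + ‖ψ‖) ^ 2 / 2 := fun φ ψ => by
    have hC0 : 0 ≤ C := (abs_nonneg _).trans (hC 0)
    have h1 : |q (φ + ψ)| ≤ C * (‖φ‖ + ‖ψ‖) ^ 2 :=
      (hqb _).trans (by gcongr; exact norm_add_le _ _)
    have h2 : |q (φ - ψ)| ≤ C * (‖φ‖ + ‖ψ‖) ^ 2 :=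
      (hqb _).trans (by gcongr; exact norm_sub_le _ _)
    simp only [hR]
    rw [abs_div, abs_of_pos (by norm_num : (0 : ℝ) < 4)]
    linarith [abs_sub (q (φ + ψ)) (q (φ - ψ))]
  have hL : ∀ φ, ∃ v : ℋ, ∀ ψ, (⟪v, ψ⟫_ℂ).re = R φ ψ := by
    intro φ
    let L : ℋ →ₗ[ℝ] ℝ :=
      { toFun := R φ
        map_add' := Radd φ
        map_smul' := fun c ψ => by simpa using Rreal' c φ ψ }
    obtain ⟨M, hM⟩ := LinearMap.bound_of_ball_bound (r := 1) one_pos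
      (C * (‖φ‖ + 1) ^ 2 / 2) L (fun ψ hψ => by
        have hC0 : 0 ≤ C := (abs_nonneg _).trans (hC 0)
        refine (Rb φ ψ).trans ?_
        have : ‖ψ‖ ≤ 1 := (mem_ball_zero_iff.1 hψ).le
        gcongr)
    refine ⟨(InnerProductSpace.toDual ℂ ℋ).symm (StrongDual.extendRCLike (𝕜 := ℂ)
      (L.mkContinuous M hM)), fun ψ => ?_⟩
    rw [InnerProductSpace.toDual_symm_apply]
    exact StrongDual.re_extendRCLike_apply (𝕜 := ℂ) (L.mkContinuous M hM) ψ
  choose v hv using hL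
  have ext : ∀ u w : ℋ, (∀ ψ, (⟪u, ψ⟫_ℂ).re = (⟪w, ψ⟫_ℂ).re) → u = w := by
    intro u w h
    have h1 := h (u - w)
    rw [← sub_eq_zero, ← Complex.sub_re, ← inner_sub_left] at h1
    exact sub_eq_zero.1 (inner_self_eq_zero.1 (Complex.ext h1 (inner_self_im (𝕜 := ℂ) _)))
  let F : ℋ →ₗ[ℂ] ℋ :=
    { toFun := v
      map_add' := fun φ₁ φ₂ => ext _ _ fun ψ => by
        rw [inner_add_left, Complex.add_re, hv, hv, hv, Radd']
      map_smul' := fun c φ => ext _ _ fun ψ => by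
        simp only [RingHom.id_apply]
        rw [inner_smul_left, ← inner_smul_right, hv, hv, Rsmul] }
  have hre : ∀ φ ψ, (⟪v φ, ψ⟫_ℂ).re = (⟪φ, v ψ⟫_ℂ).re := fun φ ψ => by
    rw [hv, ← inner_conj_symm, Complex.conj_re, hv, Rcomm]
  have hF : F.IsSymmetric := fun φ ψ => by
    refine Complex.ext (hre φ ψ) ?_
    have h := hre φ (Complex.I • ψ)
    have h2 : v (Complex.I • ψ) = Complex.I • v ψ := F.map_smul _ _
    rw [h2, inner_smul_right, inner_smul_right] at h
    have h3 : (⟪v φ, ψ⟫_ℂ).im = (⟪φ, v ψ⟫_ℂ).im := by simpa using h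
    exact h3
  refine ⟨⟨F, hF.continuous⟩, fun ψ => ?_⟩
  have h1 : ⟪F ψ, ψ⟫_ℂ = ⟪ψ, F ψ⟫_ℂ := hF ψ ψ
  change ⟪ψ, F ψ⟫_ℂ = (q ψ : ℂ)
  refine Complex.ext ?_ ?_
  · rw [← h1]
    change (⟪v ψ, ψ⟫_ℂ).re = _
    rw [hv, Complex.ofReal_re]
    simp only [hR]
    rw [← two_smul ℂ, qsmul, sub_self, q0]
    norm_num
  · have h2 := inner_conj_symm (𝕜 := ℂ) ψ (F ψ)
    rw [h1] at h2
    rw [Complex.ofReal_im]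
    exact Complex.conj_eq_iff_im.1 h2

open Classical in
/-- The Borel functional calculus `f(T)` of the self-adjoint operator `T`, for bounded Borel functions `f`
(see `borelCalculus_spec`). -/
def borelCalculus (T : ℋ →L[ℂ] ℋ) (f : ℝ → ℝ) : ℋ →L[ℂ] ℋ :=
  if h : ∃ F : ℋ →L[ℂ] ℋ, IsBorelCalculus T f F then h.choose else 0

theorem borelCalculus_spec (T : ℋ →L[ℂ] ℋ) {f : ℝ → ℝ} (hf : Measurable f) {C : ℝ}
    (hC : ∀ x, |f x| ≤ C) : IsBorelCalculus T f (borelCalculus T f) := by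
  have h := exists_isBorelCalculus T hf hC
  rw [borelCalculus, dif_pos h]
  exact h.choose_spec

/-- The spectral projection `χ_I(T)`. -/
def spectralProjection (T : ℋ →L[ℂ] ℋ) (I : Set ℝ) : ℋ →L[ℂ] ℋ :=
  borelCalculus T (I.indicator 1)

variable (ℋ) in
/-- A fixed orthonormal basis of the Hilbert space. -/
def onb : HilbertBasis (Classical.choose (exists_hilbertBasis ℂ ℋ) : Set ℋ) ℂ ℋ :=
  Classical.choose (Classical.choose_spec (exists_hilbertBasis ℂ ℋ))

/-- The trace norm `‖T‖₁ = tr |T|`, an element of `[0, ∞]`, where `|T| = (T* T)^(1/2)`. -/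
def traceNorm (T : ℋ →L[ℂ] ℋ) : ℝ≥0∞ :=
  ∑' i, ENNReal.ofReal (⟪onb ℋ i, CFC.abs T (onb ℋ i)⟫_ℂ).re

/-- Trace class operators. -/
def IsTraceClass (T : ℋ →L[ℂ] ℋ) : Prop := traceNorm T < ∞

/-- The trace `∑ ⟪e_i, T e_i⟫`, which does not depend on the orthonormal basis if `T` is trace class. -/
def trace (T : ℋ →L[ℂ] ℋ) : ℂ := ∑' i, ⟪onb ℋ i, T (onb ℋ i)⟫_ℂ

/-- The Hilbert space sum `K ⊗ ℂ² = K ⊕ K`; its vectors are written `(ψ⁺, ψ⁻)`. -/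
abbrev Dimer (K : Type*) := WithLp 2 (K × K)

section
variable {K K' : Type*} [NormedAddCommGroup K] [InnerProductSpace ℂ K]
  [NormedAddCommGroup K'] [InnerProductSpace ℂ K']

/-- The operator with block matrix `!![a, b; c, d]`. -/
def blockOp (a b c d : K →L[ℂ] K') : Dimer K →L[ℂ] Dimer K' :=
  ((WithLp.prodContinuousLinearEquiv 2 ℂ K' K').symm : (K' × K') →L[ℂ] Dimer K') ∘L
    ((a.coprod b).prod (c.coprod d)) ∘L
    (WithLp.prodContinuousLinearEquiv 2 ℂ K K : Dimer K →L[ℂ] (K × K))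

theorem blockOp_apply (a b c d : K →L[ℂ] K') (ψ : Dimer K) :
    blockOp a b c d ψ = WithLp.toLp 2 (a ψ.fst + b ψ.snd, c ψ.fst + d ψ.snd) := rfl

variable (K) in
/-- The chiral symmetry `Π = !![1, 0; 0, -1]`. -/
def chirality : Dimer K →L[ℂ] Dimer K := blockOp 1 0 0 (-1)

/-- The Hamiltonian `!![0, S*; S, 0]`. -/
def chiralHamiltonian [CompleteSpace K] (S : K →L[ℂ] K) : Dimer K →L[ℂ] Dimer K :=
  blockOp 0 (ContinuousLinearMap.adjoint S) S 0

theorem chiralHamiltonian_isSelfAdjoint [CompleteSpace K] (S : K →L[ℂ] K) :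
    IsSelfAdjoint (chiralHamiltonian S) := by
  rw [ContinuousLinearMap.isSelfAdjoint_iff_isSymmetric]
  intro φ ψ
  simp [chiralHamiltonian, blockOp_apply, WithLp.prod_inner_apply,
    ContinuousLinearMap.adjoint_inner_left, ContinuousLinearMap.adjoint_inner_right, add_comm]

theorem chiralHamiltonian_anticomm [CompleteSpace K] (S : K →L[ℂ] K) :
    chiralHamiltonian S * chirality K + chirality K * chiralHamiltonian S = 0 := by
  refine ContinuousLinearMap.ext fun ψ => ?_
  simp only [add_apply, mul_apply_eq_comp, chiralHamiltonian,
    chirality, blockOp_apply, ← WithLp.toLp_add, Prod.mk_add_mk]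
  simp
end

/-- The internal space `ℂ^N` of a site. -/
abbrev Internal (N : ℕ) := EuclideanSpace ℂ (Fin N)

/-- The Hilbert space `ℓ²(X, ℂ^N)`. -/
abbrev Ell (X : Type) (N : ℕ) : Type := lp (fun _ : X => Internal N) 2

section
variable {N : ℕ} {X Y : Type}

theorem norm_sq_le_aux {M : ℝ} {T : X → Internal N →L[ℂ] Internal N} (hT : ∀ x, ‖T x‖ ≤ M)
    (ψ : Ell Y N) (e : X → Y) (x : X) :
    ‖T x (ψ (e x))‖ ^ (2 : ℝ≥0∞).toReal ≤ M ^ 2 * ‖ψ (e x)‖ ^ (2 : ℝ≥0∞).toReal := by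
  simp only [ENNReal.toReal_ofNat, Real.rpow_two, ← mul_pow]
  gcongr
  exact (T x).le_of_opNorm_le (hT x) _

theorem summable_norm_sq (ψ : Ell Y N) : Summable fun y => ‖ψ y‖ ^ (2 : ℝ≥0∞).toReal :=
  (lp.memℓp ψ).summable (by norm_num)

/-- The operator `(hop T e ψ)(x) = T(x) ψ(e(x))`, for a bounded family of matrices `T` and an injection `e`. -/
def hop (T : X → Internal N →L[ℂ] Internal N) (hT : ∃ M : ℝ, ∀ x, ‖T x‖ ≤ M)
    (e : X ↪ Y) : Ell Y N →L[ℂ] Ell X N :=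
  LinearMap.mkContinuousOfExistsBound
    { toFun := fun ψ => ⟨fun x => T x (ψ (e x)), memℓp_gen (by
        obtain ⟨M, hM⟩ := hT
        exact Summable.of_nonneg_of_le (fun _ => by positivity) (norm_sq_le_aux hM ψ e)
          (((summable_norm_sq ψ).comp_injective e.injective).mul_left _))⟩
      map_add' := fun φ ψ => by
        ext x : 2
        exact map_add (T x) (φ (e x)) (ψ (e x))
      map_smul' := fun c ψ => by
        ext x : 2
        exact map_smul (T x) c (ψ (e x)) }
    (by
      obtain ⟨M, hM⟩ := hT
      refine ⟨|M|, fun ψ => ?_⟩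
      refine lp.norm_le_of_tsum_le (by norm_num) (by positivity) ?_
      calc _ ≤ ∑' x, M ^ 2 * ‖ψ (e x)‖ ^ (2 : ℝ≥0∞).toReal :=
            Summable.tsum_le_tsum (norm_sq_le_aux hM ψ e)
              (Summable.of_nonneg_of_le (fun _ => by positivity) (norm_sq_le_aux hM ψ e)
                (((summable_norm_sq ψ).comp_injective e.injective).mul_left _))
              (((summable_norm_sq ψ).comp_injective e.injective).mul_left _)
        _ ≤ M ^ 2 * ∑' y, ‖ψ y‖ ^ (2 : ℝ≥0∞).toReal := by
            rw [tsum_mul_left]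
            gcongr
            exact ((summable_norm_sq ψ).comp_injective e.injective).tsum_le_tsum_of_inj e
              e.injective (fun _ _ => by positivity) (fun _ => le_rfl) (summable_norm_sq ψ)
        _ = (|M| * ‖ψ‖) ^ (2 : ℝ≥0∞).toReal := by
            rw [← lp.norm_rpow_eq_tsum (by norm_num)]
            simp [mul_pow])

theorem hop_apply (T : X → Internal N →L[ℂ] Internal N) (hT : ∃ M : ℝ, ∀ x, ‖T x‖ ≤ M)
    (e : X ↪ Y) (ψ : Ell Y N) (x : X) : hop T hT e ψ x = T x (ψ (e x)) := rfl

/-- The embedding of the internal space `ℂ^{2N}` of the dimer at `x`. -/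
def siteEmbedding (x : X) : Dimer (Internal N) →L[ℂ] Dimer (Ell X N) :=
  open Classical in
  blockOp (lp.singleContinuousLinearMap ℂ (fun _ : X => Internal N) 2 x) 0 0
    (lp.singleContinuousLinearMap ℂ (fun _ : X => Internal N) 2 x)

/-- The matrix element `T(x, y) = ⟪δ_x, T δ_y⟫ : ℂ^{2N} → ℂ^{2N}`. -/
def kernel (T : Dimer (Ell X N) →L[ℂ] Dimer (Ell X N)) (x y : X) :
    Dimer (Internal N) →L[ℂ] Dimer (Internal N) :=
  ContinuousLinearMap.adjoint (siteEmbedding x) ∘L T ∘L siteEmbedding y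

/-- The sum `∑_{x, y} ‖P(x, y)‖₁ (1 + |x|)^(-ν) e^{μ |x - y|}`, with `pos x` the position of the site `x` in `ℤ`. -/
def decaySum (pos : X → ℤ) (P : Dimer (Ell X N) →L[ℂ] Dimer (Ell X N)) (μ ν : ℝ) : ℝ≥0∞ :=
  ∑' (x : X) (y : X), traceNorm (kernel P x y) *
    ENNReal.ofReal ((1 + |(pos x : ℝ)|) ^ (-ν) * Real.exp (μ * |(pos x : ℝ) - pos y|))

theorem hasSum_extend_aux (a : ℤ) (ψ : Ell (Set.Iic a) N) :
    HasSum (fun n : ℤ => ‖(if h : n ≤ a then ψ ⟨n, h⟩ else 0 : Internal N)‖ ^ (2 : ℝ≥0∞).toReal)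
      (‖ψ‖ ^ (2 : ℝ≥0∞).toReal) := by
  refine (Function.Injective.hasSum_iff (f := fun n : ℤ =>
    ‖(if h : n ≤ a then ψ ⟨n, h⟩ else 0 : Internal N)‖ ^ (2 : ℝ≥0∞).toReal)
    (g := (Subtype.val : Set.Iic a → ℤ)) Subtype.val_injective ?_).1 ?_
  · intro n hn
    have : ¬ n ≤ a := fun h => hn ⟨⟨n, h⟩, rfl⟩
    simp [this]
  · refine (lp.hasSum_norm (by norm_num) ψ).congr_fun ?_
    intro n
    have : (n : ℤ) ≤ a := n.2
    simp [this]

variable (N) in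
/-- The injection `ι_a : ℓ²((-∞, a], ℂ^N) → ℓ²(ℤ, ℂ^N)`, extension by zero. -/
def halfLineInclusion (a : ℤ) : Ell (Set.Iic a) N →L[ℂ] Ell ℤ N :=
  (LinearIsometry.mk
    { toFun := fun ψ => ⟨fun n => if h : n ≤ a then ψ ⟨n, h⟩ else 0, memℓp_gen ((hasSum_extend_aux a ψ).summable)⟩
      map_add' := fun φ ψ => by
        ext n : 2
        change (if h : n ≤ a then φ ⟨n, h⟩ + ψ ⟨n, h⟩ else 0) =
          (if h : n ≤ a then φ ⟨n, h⟩ else 0) + if h : n ≤ a then ψ ⟨n, h⟩ else 0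
        by_cases h : n ≤ a <;> simp [h]
      map_smul' := fun c ψ => by
        ext n : 2
        by_cases h : n ≤ a <;> simp [h] }
    (fun ψ => by
      have h := lp.hasSum_norm (p := 2) (by norm_num)
        (⟨fun n => if h : n ≤ a then ψ ⟨n, h⟩ else 0,
          memℓp_gen (hasSum_extend_aux a ψ).summable⟩ : Ell ℤ N)
      have h2 := h.unique (hasSum_extend_aux a ψ)
      simp only [ENNReal.toReal_ofNat, Real.rpow_two] at h2
      exact (sq_eq_sq₀ (norm_nonneg _) (norm_nonneg _)).1 h2)).toContinuousLinearMap

theorem halfLineInclusion_apply (a : ℤ) (ψ : Ell (Set.Iic a) N) (n : ℤ) :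
    halfLineInclusion N a ψ n = if h : n ≤ a then ψ ⟨n, h⟩ else 0 := rfl

theorem halfLineInclusion_single (a : ℤ) (n : Set.Iic a) (v : Internal N) :
    halfLineInclusion N a (lp.single 2 n v) = lp.single 2 (n : ℤ) v := by
  ext m : 2
  rw [halfLineInclusion_apply]
  by_cases hm : m ≤ a
  · rw [dif_pos hm]
    simp only [lp.single_apply, Pi.single_apply, Subtype.ext_iff]
  · have hne : m ≠ n := fun h => hm (h ▸ n.2)
    rw [dif_neg hm, lp.single_apply, Pi.single_eq_of_ne hne]

theorem inner_single_eq [DecidableEq X] (x : X) (v : Internal N) (ψ : Ell X N) :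
    ⟪(lp.single 2 x v : Ell X N), ψ⟫_ℂ = ⟪v, ψ x⟫_ℂ :=
  lp.inner_single_left (𝕜 := ℂ) (G := fun _ : X => Internal N) x v ψ

/-- The adjoint of `ι_a` is the restriction. -/
theorem adjoint_halfLineInclusion_apply (a : ℤ) (ψ : Ell ℤ N) (n : Set.Iic a) :
    ContinuousLinearMap.adjoint (halfLineInclusion N a) ψ n = ψ n := by
  have key : ∀ χ : Ell (Set.Iic a) N,
      χ = ContinuousLinearMap.adjoint (halfLineInclusion N a) ψ → χ n = ψ n := by
    intro χ hχ
    have h : ∀ v : Internal N, ⟪v, χ n⟫_ℂ = ⟪v, ψ n⟫_ℂ := by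
      intro v
      rw [← inner_single_eq, ← inner_single_eq, ← halfLineInclusion_single, hχ,
        ContinuousLinearMap.adjoint_inner_right]
    exact ext_inner_left ℂ h
  exact key _ rfl

end

/-- Switch functions: `Λ n = 1` and `Λ (-n) = 0` for large positive `n`. -/
structure IsSwitch (Λ : ℤ → ℝ) : Prop where
  eventually_one : ∀ᶠ n in Filter.atTop, Λ n = 1
  eventually_zero : ∀ᶠ n in Filter.atBot, Λ n = 0

theorem IsSwitch.bounded {Λ : ℤ → ℝ} (h : IsSwitch Λ) (N : ℕ) :
    ∃ M : ℝ, ∀ n, ‖((Λ n : ℂ) • (1 : Internal N →L[ℂ] Internal N))‖ ≤ M := by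
  obtain ⟨a, ha⟩ := Filter.eventually_atTop.1 h.eventually_one
  obtain ⟨b, hb⟩ := Filter.eventually_atBot.1 h.eventually_zero
  refine ⟨1 + ∑ k ∈ Finset.Icc b a, |Λ k|, fun n => ?_⟩
  have h0 : 0 ≤ ∑ k ∈ Finset.Icc b a, |Λ k| := Finset.sum_nonneg fun _ _ => abs_nonneg _
  have h1 : |Λ n| ≤ 1 + ∑ k ∈ Finset.Icc b a, |Λ k| := by
    rcases le_total a n with h | h
    · rw [ha n h]; simpa using h0
    rcases le_total n b with h' | h'
    · rw [hb n h']; simp; linarith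
    have := Finset.single_le_sum (f := fun k => |Λ k|) (fun _ _ => abs_nonneg _)
      (Finset.mem_Icc.2 ⟨h', h⟩)
    linarith [this]
  rw [norm_smul]
  calc _ ≤ |Λ n| * 1 := by
        rw [Complex.norm_real, Real.norm_eq_abs]
        gcongr
        exact ContinuousLinearMap.norm_id_le
    _ ≤ _ := by rwa [mul_one]

/-- Multiplication by `Λ` on `ℓ²(ℤ, ℂ^N) ⊗ ℂ²`. -/
def switchOp (N : ℕ) {Λ : ℤ → ℝ} (hΛ : IsSwitch Λ) : Dimer (Ell ℤ N) →L[ℂ] Dimer (Ell ℤ N) :=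
  blockOp (hop (fun n => (Λ n : ℂ) • 1) (hΛ.bounded N) (Function.Embedding.refl ℤ)) 0 0
    (hop (fun n => (Λ n : ℂ) • 1) (hΛ.bounded N) (Function.Embedding.refl ℤ))

/-- An invertible matrix as an operator on `ℂ^N`. -/
def matOp {N : ℕ} (g : GL (Fin N) ℂ) : Internal N →L[ℂ] Internal N :=
  Matrix.toEuclideanCLM (𝕜 := ℂ) (g : Matrix (Fin N) (Fin N) ℂ)

/-- The data of the model: hopping matrices `A n, B n ∈ GL_N(ℂ)`, bounded in `n` (in operator norm). The bounds
say precisely that `S` below is defined on all of `ℓ²(ℤ, ℂ^N)`. -/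
structure ChiralChain (N : ℕ) where
  A : ℤ → GL (Fin N) ℂ
  B : ℤ → GL (Fin N) ℂ
  bounded_A : ∃ M : ℝ, ∀ n, ‖matOp (A n)‖ ≤ M
  bounded_B : ∃ M : ℝ, ∀ n, ‖matOp (B n)‖ ≤ M

namespace ChiralChain
variable {N : ℕ} (M : ChiralChain N)

/-- The operator `(S ψ)_n = A_n ψ_{n-1} + B_n ψ_n`. -/
def S : Ell ℤ N →L[ℂ] Ell ℤ N :=
  hop (fun n => matOp (M.A n)) M.bounded_A (Equiv.subRight 1).toEmbedding +
    hop (fun n => matOp (M.B n)) M.bounded_B (Function.Embedding.refl ℤ)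

theorem S_apply (ψ : Ell ℤ N) (n : ℤ) :
    M.S ψ n = matOp (M.A n) (ψ (n - 1)) + matOp (M.B n) (ψ n) := rfl

/-- The bulk Hamiltonian. -/
def H : Dimer (Ell ℤ N) →L[ℂ] Dimer (Ell ℤ N) := chiralHamiltonian M.S

/-- The truncation `S_a = ι_a* S ι_a`. -/
def edgeS (a : ℤ) : Ell (Set.Iic a) N →L[ℂ] Ell (Set.Iic a) N :=
  ContinuousLinearMap.adjoint (halfLineInclusion N a) ∘L M.S ∘L halfLineInclusion N a

/-- The edge Hamiltonian `H_a` on `ℓ²((-∞, a], ℂ^N) ⊗ ℂ²`. -/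
def edgeH (a : ℤ) : Dimer (Ell (Set.Iic a) N) →L[ℂ] Dimer (Ell (Set.Iic a) N) :=
  chiralHamiltonian (M.edgeS a)

/-- The Fermi projection `χ_{(-∞, 0)}(H)`. -/
def fermi : Dimer (Ell ℤ N) →L[ℂ] Dimer (Ell ℤ N) := spectralProjection M.H (Set.Iio 0)

/-- The Fermi projection `χ_{(-∞, 0)}(H_a)` of the edge Hamiltonian. -/
def edgeFermi (a : ℤ) : Dimer (Ell (Set.Iic a) N) →L[ℂ] Dimer (Ell (Set.Iic a) N) :=
  spectralProjection (M.edgeH a) (Set.Iio 0)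

/-- The mobility gap condition: for some `μ, ν > 0` the kernel of the Fermi projection decays exponentially,
and the same bound holds for the Fermi projections of all edge Hamiltonians. -/
def MobilityGap : Prop :=
  ∃ μ ν : ℝ, 0 < μ ∧ 0 < ν ∧ ∃ C : ℝ,
    decaySum id M.fermi μ ν ≤ ENNReal.ofReal C ∧
    ∀ a : ℤ, decaySum Subtype.val (M.edgeFermi a) μ ν ≤ ENNReal.ofReal C

/-- `Σ = sgn H`. -/
def sgnH : Dimer (Ell ℤ N) →L[ℂ] Dimer (Ell ℤ N) := borelCalculus M.H Real.sign

/-- The operator `Π Σ [Λ, Σ]`. -/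
def bulkOp {Λ : ℤ → ℝ} (hΛ : IsSwitch Λ) : Dimer (Ell ℤ N) →L[ℂ] Dimer (Ell ℤ N) :=
  chirality (Ell ℤ N) * M.sgnH * (switchOp N hΛ * M.sgnH - M.sgnH * switchOp N hΛ)

/-- The bulk index `½ tr (Π Σ [Λ, Σ])`. -/
def bulkIndex {Λ : ℤ → ℝ} (hΛ : IsSwitch Λ) : ℂ := 1 / 2 * trace (M.bulkOp hΛ)

/-- The operator `Π P_{0,a}`, where `P_{0,a} = χ_{{0}}(H_a)`. -/
def edgeOp (a : ℤ) : Dimer (Ell (Set.Iic a) N) →L[ℂ] Dimer (Ell (Set.Iic a) N) :=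
  chirality (Ell (Set.Iic a) N) * spectralProjection (M.edgeH a) {0}

/-- The edge index `tr (Π P_{0,a})`. -/
def edgeIndex (a : ℤ) : ℂ := trace (M.edgeOp a)
end ChiralChain
end ChiralDuality

end

open ChiralDuality

/-! The bulk is treated as the limit of edges moved to +∞. Let Σ_a be sgn H_a extended by zero to
the line. In the site basis, the trace of ΠΣ[Λ,Σ] is `switchSum Λ Σ`, the sum over p, q of
chi(q)(Λ_p − Λ_q)|⟨p, Σq⟩|² with chi the chirality; the same sum is formed with Σ_a and computed in
two ways as a → ∞.

Limit of the sums. Chirality gives Σ = ΠPΠ − P, at the edge as well, even when zero is an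
eigenvalue. The mobility gap therefore bounds the matrix elements of all Σ_a uniformly in a, and the
factor Λ_p − Λ_q makes the bound summable (`exists_summable_bound`). Strong convergence Σ_a → Σ
(`tendsto_compression_sign`) rests on sgn(T)T = |T|: on the range of H it reduces to convergence of
the continuous function |H_a|, hence of polynomials, and that range is dense because H is injective.
By dominated convergence (`tendsto_switchSum`) the edge sums tend to the bulk one.

Value at an edge. On a half-line only finitely many sites carry a nonzero Λ, so the commutator may
be opened; since Π anticommutes with Σ_a the sum is −2 tr(ΠΛΣ_a²). Here Σ_a² = 1 − P_{0,a} on the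
half-line, ΠΛ is traceless there, and ΠP_{0,a} = P_{0,a}, which leaves 2 tr(ΛP_{0,a})
(`switchSum_edgeSgn`).

Zero modes. The kernel equations are two-term recursions with invertible coefficients. They show
that S_a* is injective, that a zero mode is determined by its value at the edge, and that zero modes
can be truncated and continued. Hence the edge index is dim ker H_a, which is finite and independent
of a (`finrank_zeroModes_eq`). Finally tr(ΛP_{0,a}) tends to this dimension because zero modes leave
every fixed half-line (-∞, c]: truncated to it they lie in the fixed finite-dimensional space ker
H_c, and on a unit vector f of that space ‖P_{0,a}f‖² ≤ 1 − ‖Σ_a f‖² → 1 − ‖Σf‖² = 0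
(`tendsto_switchSum_edgeSgn`). -/

namespace ChiralDuality

/-! ### Trace class operators as absolutely convergent series of rank-one operators. -/

section TraceClass
variable {ℋ : Type*} [NormedAddCommGroup ℋ] [InnerProductSpace ℂ ℋ]
open InnerProductSpace

theorem hasSum_norm_inner_sq {ι : Type*} (b : HilbertBasis ι ℂ ℋ) (x : ℋ) :
    HasSum (fun i => ‖⟪b i, x⟫_ℂ‖ ^ 2) (‖x‖ ^ 2) := by
  have h := b.hasSum_inner_mul_inner x x
  rw [inner_self_eq_norm_sq_to_K] at h
  have h2 := Complex.hasSum_re h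
  have h3 : ((((‖x‖ : ℝ) : ℂ) ^ 2 : ℂ)).re = ‖x‖ ^ 2 := by norm_cast
  have h4 : HasSum (fun i => (⟪x, b i⟫_ℂ * ⟪b i, x⟫_ℂ).re) (‖x‖ ^ 2) := h3 ▸ h2
  refine h4.congr_fun fun i => ?_
  rw [← inner_conj_symm x, ← Complex.normSq_eq_conj_mul_self, Complex.ofReal_re,
    Complex.normSq_eq_norm_sq]

/-- Cauchy–Schwarz, then Bessel on each factor. -/
theorem sum_norm_inner_mul_norm_inner_le {ι : Type*} {e : ι → ℋ} (he : Orthonormal ℂ e)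
    (u v : ℋ) (F : Finset ι) : ∑ i ∈ F, ‖⟪e i, u⟫_ℂ‖ * ‖⟪v, e i⟫_ℂ‖ ≤ ‖u‖ * ‖v‖ := by
  refine (Real.sum_mul_le_sqrt_mul_sqrt F _ _).trans ?_
  gcongr
  · exact (Real.sqrt_le_left (norm_nonneg _)).2 (he.sum_inner_products_le u)
  · refine (Real.sqrt_le_left (norm_nonneg _)).2 ?_
    simp_rw [norm_inner_symm v]
    exact he.sum_inner_products_le v

variable {κ : Type*} {u v : κ → ℋ} {T : ℋ →L[ℂ] ℋ}

/-- This joint summability licenses exchanging the sum over the rank-one terms with the sum over a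
basis. -/
theorem summable_inner_mul_inner_of_summable {ι : Type*} {e : ι → ℋ} (he : Orthonormal ℂ e)
    (hs : Summable fun k => ‖u k‖ * ‖v k‖) :
    Summable fun p : κ × ι => ‖⟪e p.2, u p.1⟫_ℂ‖ * ‖⟪v p.1, e p.2⟫_ℂ‖ := by
  have h1 : ∀ k, Summable fun i => ‖⟪e i, u k⟫_ℂ‖ * ‖⟪v k, e i⟫_ℂ‖ := fun k =>
    summable_of_sum_le (fun i => by positivity) (sum_norm_inner_mul_norm_inner_le he (u k) (v k))
  refine (summable_prod_of_nonneg fun p => by positivity).2 ⟨h1, ?_⟩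
  refine Summable.of_nonneg_of_le (fun k => tsum_nonneg fun i => by positivity) (fun k => ?_) hs
  exact (h1 k).tsum_le_of_sum_le (sum_norm_inner_mul_norm_inner_le he (u k) (v k))

theorem hasSum_inner_rankOne (hT : HasSum (fun k => rankOne ℂ (u k) (v k)) T) (x y : ℋ) :
    HasSum (fun k => ⟪x, u k⟫_ℂ * ⟪v k, y⟫_ℂ) ⟪x, T y⟫_ℂ := by
  have h := ((innerSL ℂ x).comp (ContinuousLinearMap.apply ℂ ℋ y)).hasSum hT
  refine (h.congr_fun fun k => ?_)
  simp [mul_comm]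

theorem sum_norm_inner_le_of_hasSum_rankOne {ι : Type*} {e : ι → ℋ} (he : Orthonormal ℂ e)
    (hT : HasSum (fun k => rankOne ℂ (u k) (v k)) T) (hs : Summable fun k => ‖u k‖ * ‖v k‖)
    (F : Finset ι) : ∑ i ∈ F, ‖⟪e i, T (e i)⟫_ℂ‖ ≤ ∑' k, ‖u k‖ * ‖v k‖ := by
  have h := summable_inner_mul_inner_of_summable he hs
  have hsw : ∀ i, Summable fun k => ‖⟪e i, u k⟫_ℂ‖ * ‖⟪v k, e i⟫_ℂ‖ := fun i =>
    h.comp_injective (i := fun k => (k, i)) fun a b hab => (Prod.mk.inj hab).1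
  calc ∑ i ∈ F, ‖⟪e i, T (e i)⟫_ℂ‖
      ≤ ∑ i ∈ F, ∑' k, ‖⟪e i, u k⟫_ℂ‖ * ‖⟪v k, e i⟫_ℂ‖ := by
        gcongr with i
        rw [← (hasSum_inner_rankOne hT _ _).tsum_eq]
        simp_rw [← norm_mul]
        exact norm_tsum_le_tsum_norm (by simpa only [norm_mul] using hsw i)
    _ = ∑' k, ∑ i ∈ F, ‖⟪e i, u k⟫_ℂ‖ * ‖⟪v k, e i⟫_ℂ‖ :=
        (Summable.tsum_finsetSum fun i _ => hsw i).symm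
    _ ≤ _ := Summable.tsum_le_tsum (fun k => sum_norm_inner_mul_norm_inner_le he _ _ F)
        (summable_sum fun i _ => hsw i) hs

variable [CompleteSpace ℋ]

/-- The trace of a nuclear operator. -/
theorem trace_eq_of_hasSum_rankOne (hT : HasSum (fun k => rankOne ℂ (u k) (v k)) T)
    (hs : Summable fun k => ‖u k‖ * ‖v k‖) : trace T = ∑' k, ⟪v k, u k⟫_ℂ := by
  have h := summable_inner_mul_inner_of_summable (onb ℋ).orthonormal hs
  have h2 : Summable fun p : κ × _ => ⟪onb ℋ p.2, u p.1⟫_ℂ * ⟪v p.1, onb ℋ p.2⟫_ℂ :=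
    Summable.of_norm (by simpa only [norm_mul] using h)
  calc trace T = ∑' i, ∑' k, ⟪onb ℋ i, u k⟫_ℂ * ⟪v k, onb ℋ i⟫_ℂ :=
        tsum_congr fun i => (hasSum_inner_rankOne hT _ _).tsum_eq.symm
    _ = ∑' k, ∑' i, ⟪onb ℋ i, u k⟫_ℂ * ⟪v k, onb ℋ i⟫_ℂ := Summable.tsum_comm h2
    _ = ∑' k, ⟪v k, u k⟫_ℂ := tsum_congr fun k => by
        rw [← (onb ℋ).tsum_inner_mul_inner]
        exact tsum_congr fun i => mul_comm _ _

/-- An approximate polar decomposition. -/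
theorem exists_contraction_abs_sub_le (T : ℋ →L[ℂ] ℋ) {ε : ℝ} (hε : 0 < ε) :
    ∃ W : ℋ →L[ℂ] ℋ, ‖W‖ ≤ 1 ∧ ‖CFC.abs T - W * T‖ ≤ ε := by
  set R := CFC.abs T with hR
  have hR0 : 0 ≤ R := CFC.abs_nonneg T
  have hRs : IsSelfAdjoint R := hR0.isSelfAdjoint
  have hpos : ∀ x : ℝ, 0 < |x| + ε := fun x => by positivity
  -- The exact partial isometry would be |T|⁻¹T*, singular at 0. The regularised inverse is
  -- continuous, and W = g(|T|)T* satisfies WT = g(|T|)|T|², which differs from |T| by εx/(x + ε) ≤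
  -- ε on the spectrum.
  set g : ℝ → ℝ := fun x => (|x| + ε)⁻¹ with hg
  have hgc : Continuous g :=
    (continuous_abs.add continuous_const).inv₀ fun x => (hpos x).ne'
  have hgs : star (cfc g R) = cfc g R := (cfc_predicate g R : IsSelfAdjoint _)
  have hsq : cfc (fun x : ℝ => x * x) R = star T * T := by
    rw [cfc_mul (fun x : ℝ => x) (fun x : ℝ => x) R, cfc_id' ℝ R, hR, CFC.abs_mul_abs]
  refine ⟨cfc g R * star T, ?_, ?_⟩
  · have h1 : (cfc g R * star T) * star (cfc g R * star T) =
        cfc (fun x => g x * (x * x) * g x) R := by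
      rw [star_mul, star_star, hgs, cfc_mul (fun x => g x * (x * x)) g R
        (by fun_prop) (by fun_prop), cfc_mul g (fun x => x * x) R (by fun_prop) (by fun_prop), hsq]
      noncomm_ring
    have h2 : ‖cfc (fun x => g x * (x * x) * g x) R‖ ≤ 1 := by
      refine norm_cfc_le zero_le_one fun x _ => ?_
      have := hpos x
      have hgx : 0 < g x := inv_pos.2 this
      rw [Real.norm_of_nonneg (mul_nonneg (mul_nonneg hgx.le (mul_self_nonneg x)) hgx.le)]
      simp only [hg]
      rw [inv_mul_eq_div, ← div_eq_mul_inv, div_div, div_le_one (by positivity), ← abs_mul_abs_self x]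
      gcongr <;> linarith
    rw [← h1, CStarRing.norm_self_mul_star] at h2
    nlinarith [norm_nonneg (cfc g R * star T)]
  · have h1 : R - cfc g R * star T * T = cfc (fun x => x - g x * (x * x)) R := by
      rw [cfc_sub (fun x : ℝ => x) (fun x => g x * (x * x)) R (by fun_prop) (by fun_prop),
        cfc_mul g (fun x => x * x) R (by fun_prop) (by fun_prop), hsq, cfc_id' ℝ R, mul_assoc]
    rw [h1]
    refine norm_cfc_le hε.le fun x hx => ?_
    have hx0 : 0 ≤ x := spectrum_nonneg_of_nonneg hR0 hx
    have hp : 0 < x + ε := by positivity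
    have : x - g x * (x * x) = ε * (x / (x + ε)) := by
      simp only [hg, abs_of_nonneg hx0]
      field_simp
      ring
    rw [this, Real.norm_of_nonneg (by positivity)]
    exact mul_le_of_le_one_right hε.le ((div_le_one hp).2 (by linarith))

/-- Nuclear operators are trace class. -/
theorem isTraceClass_of_hasSum_rankOne (hT : HasSum (fun k => rankOne ℂ (u k) (v k)) T)
    (hs : Summable fun k => ‖u k‖ * ‖v k‖) : IsTraceClass T := by
  set b := onb ℋ
  set L := ∑' k, ‖u k‖ * ‖v k‖
  have hb : ∀ i, ‖b i‖ = 1 := b.orthonormal.1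
  have hle : ∀ F : Finset _, ∑ i ∈ F, (⟪b i, CFC.abs T (b i)⟫_ℂ).re ≤ L := by
    intro F
    refine le_of_forall_pos_le_add fun δ hδ => ?_
    -- Each basis vector of F costs one ε; the summand 1 covers empty F.
    set ε := δ / (F.card + 1) with hε
    have hε0 : 0 < ε := by positivity
    obtain ⟨W, hW, hWT⟩ := exists_contraction_abs_sub_le T hε0
    have hT' : HasSum (fun k => rankOne ℂ (W (u k)) (v k)) (W * T) := by
      have h := (ContinuousLinearMap.compL ℂ ℋ ℋ ℋ W).hasSum hT
      refine h.congr_fun fun k => ?_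
      ext x
      simp
    have hle' : ∀ k, ‖W (u k)‖ * ‖v k‖ ≤ ‖u k‖ * ‖v k‖ := fun k => by
      gcongr
      simpa using W.le_of_opNorm_le hW (u k)
    have hs' : Summable fun k => ‖W (u k)‖ * ‖v k‖ :=
      Summable.of_nonneg_of_le (fun k => by positivity) hle' hs
    have h1 := sum_norm_inner_le_of_hasSum_rankOne b.orthonormal hT' hs' F
    have h2 := hs'.tsum_le_tsum hle' hs
    calc ∑ i ∈ F, (⟪b i, CFC.abs T (b i)⟫_ℂ).re
        ≤ ∑ i ∈ F, (‖⟪b i, (W * T) (b i)⟫_ℂ‖ + ε) := by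
          gcongr with i
          have : CFC.abs T (b i) = (W * T) (b i) + (CFC.abs T - W * T) (b i) := by simp
          rw [this, inner_add_right, Complex.add_re]
          gcongr
          · exact Complex.re_le_norm _
          · refine (Complex.re_le_norm _).trans ((norm_inner_le_norm _ _).trans ?_)
            rw [hb, one_mul]
            simpa [hb] using (CFC.abs T - W * T).le_of_opNorm_le hWT (b i)
      _ = ∑ i ∈ F, ‖⟪b i, (W * T) (b i)⟫_ℂ‖ + F.card * ε := by
          simp [Finset.sum_add_distrib]
      _ ≤ L + δ := by
          have : F.card * ε ≤ δ := by
            rw [hε, mul_div_assoc', div_le_iff₀ (by positivity)]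
            nlinarith
          linarith
  refine lt_of_le_of_lt (ENNReal.summable.tsum_le_of_sum_le (a₂ := ENNReal.ofReal L) fun F => ?_)
    ENNReal.ofReal_lt_top
  rw [← ENNReal.ofReal_sum_of_nonneg]
  · exact ENNReal.ofReal_le_ofReal (hle F)
  · intro i _
    have h := CFC.abs_nonneg T
    rw [ContinuousLinearMap.nonneg_iff_isPositive] at h
    exact (Complex.le_def.1 (h.inner_nonneg_right (b i))).1

/-- With A = |T|^(1/2), the trace norm is the squared Hilbert–Schmidt norm of A, which dominates
‖A‖² = ‖T‖. It converts the trace norms in the gap condition into operator norms. -/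
theorem ofReal_norm_le_traceNorm (T : ℋ →L[ℂ] ℋ) : ENNReal.ofReal ‖T‖ ≤ traceNorm T := by
  by_cases htop : traceNorm T = ∞
  · simp [htop]
  set R := CFC.abs T with hR
  have hR0 : 0 ≤ R := CFC.abs_nonneg T
  set A := CFC.sqrt R with hA
  have hAA : A * A = R := CFC.sqrt_mul_sqrt_self R hR0
  have hAs : star A = A := (CFC.sqrt_nonneg R).isSelfAdjoint
  have hAadj : ContinuousLinearMap.adjoint A = A := hAs
  set b := onb ℋ
  have hb : ∀ i, (⟪b i, R (b i)⟫_ℂ).re = ‖A (b i)‖ ^ 2 := fun i => by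
    rw [← hAA, mul_apply_eq_comp, ← hAadj, ContinuousLinearMap.adjoint_inner_right, hAadj,
      ← inner_self_eq_norm_sq (𝕜 := ℂ)]
    rfl
  have hsum : Summable fun i => ‖A (b i)‖ ^ 2 := by
    have := ENNReal.summable_toReal htop
    refine this.congr fun i => ?_
    rw [hb, ENNReal.toReal_ofReal (by positivity)]
  have htn : traceNorm T = ENNReal.ofReal (∑' i, ‖A (b i)‖ ^ 2) := by
    rw [ENNReal.ofReal_tsum_of_nonneg (fun i => by positivity) hsum]
    exact tsum_congr fun i => by rw [← hb]
  rw [htn]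
  refine ENNReal.ofReal_le_ofReal ?_
  have hAn : ‖A‖ ≤ √(∑' i, ‖A (b i)‖ ^ 2) := by
    refine A.opNorm_le_bound (Real.sqrt_nonneg _) fun x => ?_
    rw [← Real.sqrt_sq (norm_nonneg x), ← Real.sqrt_mul (tsum_nonneg fun i => by positivity)]
    refine Real.le_sqrt_of_sq_le ?_
    have h1 := hasSum_norm_inner_sq b (A x)
    refine h1.tsum_eq.symm.le.trans ?_
    rw [← tsum_mul_right]
    refine Summable.tsum_le_tsum (fun i => ?_) h1.summable (hsum.mul_right _)
    rw [← mul_pow]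
    gcongr
    rw [← hAadj, ContinuousLinearMap.adjoint_inner_right, hAadj]
    exact norm_inner_le_norm _ _
  calc ‖T‖ = ‖R‖ := by rw [hR, CFC.norm_abs]
    _ = ‖A‖ * ‖A‖ := by rw [← hAA, ← CStarRing.norm_star_mul_self, hAs]
    _ ≤ √(∑' i, ‖A (b i)‖ ^ 2) * √(∑' i, ‖A (b i)‖ ^ 2) := by gcongr
    _ = _ := Real.mul_self_sqrt (tsum_nonneg fun i => by positivity)

end TraceClass

/-! ### The sign of a self-adjoint operator as a strong limit of continuous functions. -/

section BorelCalculus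
open Filter Topology
variable {ℋ : Type*} [NormedAddCommGroup ℋ] [InnerProductSpace ℂ ℋ] [CompleteSpace ℋ]
  {T : ℋ →L[ℂ] ℋ}

theorem inner_apply_self_re (hT : IsSelfAdjoint T) (ψ : ℋ) :
    ⟪ψ, T ψ⟫_ℂ = (((⟪ψ, T ψ⟫_ℂ).re : ℝ) : ℂ) := by
  rw [ContinuousLinearMap.isSelfAdjoint_iff_isSymmetric] at hT
  refine (Complex.conj_eq_iff_re.1 ?_).symm
  rw [inner_conj_symm]
  exact hT ψ ψ

/-- A continuous plateau function: `1` on `[-r, r]` and `0` outside `(-r - 1, r + 1)`. -/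
def plateau (r x : ℝ) : ℝ := max 0 (min 1 (r + 1 - |x|))

theorem plateau_eq_one {r x : ℝ} (h : |x| ≤ r) : plateau r x = 1 := by
  rw [plateau, min_eq_left (by linarith), max_eq_right zero_le_one]

theorem plateau_eq_zero {r x : ℝ} (h : r + 1 ≤ |x|) : plateau r x = 0 :=
  max_eq_left ((min_le_right _ _).trans (by linarith))

theorem abs_plateau_le (r x : ℝ) : |plateau r x| ≤ 1 := by
  rw [plateau, abs_of_nonneg (le_max_left _ _)]
  exact max_le zero_le_one (min_le_left _ _)

theorem continuous_plateau (r : ℝ) : Continuous (plateau r) := by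
  unfold plateau; fun_prop

theorem hasCompactSupport_plateau (r : ℝ) : HasCompactSupport (plateau r) := by
  refine HasCompactSupport.intro (isCompact_closedBall (0 : ℝ) (r + 1)) fun x hx => ?_
  refine plateau_eq_zero (le_of_lt ?_)
  simpa using hx

theorem abs_le_of_mem_spectrum {x : ℝ} (hx : x ∈ spectrum ℝ T) :
    |x| ≤ ‖T‖ * ‖(1 : ℋ →L[ℂ] ℋ)‖ := spectrum.norm_le_norm_mul_of_mem hx

/-- The spectral measure computes `⟪ψ, f(T) ψ⟫` for every bounded continuous `f`. -/
theorem integral_spectralMeasure_of_continuous (T : ℋ →L[ℂ] ℋ) (ψ : ℋ) {f : ℝ → ℝ}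
    (hf : Continuous f) {C : ℝ} (hC : ∀ x, |f x| ≤ C) :
    ∫ x, f x ∂(spectralMeasure T ψ) = (⟪ψ, cfc f T ψ⟫_ℂ).re := by
  -- The spectrum lies in [-R, R], where every cutoff `plateau (R + m)` equals 1. Thus the operator
  -- side does not depend on m, while m → ∞ removes the cutoff from the integral.
  set R := ‖T‖ * ‖(1 : ℋ →L[ℂ] ℋ)‖
  have h1 : ∀ m : ℕ, ∫ x, plateau (R + m) x * f x ∂(spectralMeasure T ψ) =
      (⟪ψ, cfc f T ψ⟫_ℂ).re := fun m => by
    have h := integral_spectralMeasure T ψ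
      ⟨⟨fun x => plateau (R + m) x * f x, (continuous_plateau _).mul hf⟩,
        (hasCompactSupport_plateau _).mul_right⟩
    refine h.trans ?_
    congr 3
    refine cfc_congr fun x hx => ?_
    change plateau (R + m) x * f x = f x
    rw [plateau_eq_one, one_mul]
    exact (abs_le_of_mem_spectrum hx).trans (by simp [R])
  have h2 : Tendsto (fun m : ℕ => ∫ x, plateau (R + m) x * f x ∂(spectralMeasure T ψ)) atTop
      (𝓝 (∫ x, f x ∂(spectralMeasure T ψ))) := by
    refine tendsto_integral_filter_of_dominated_convergence (fun _ => C)
      (.of_forall fun m => ((continuous_plateau _).mul hf).aestronglyMeasurable)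
      (.of_forall fun m => .of_forall fun x => ?_) (integrable_const _) (.of_forall fun x => ?_)
    · rw [norm_mul]
      exact (mul_le_of_le_one_left (norm_nonneg _) (abs_plateau_le _ _)).trans (hC x)
    · refine tendsto_const_nhds.congr' ?_
      obtain ⟨m₀, hm₀⟩ := exists_nat_ge (|x| - R)
      filter_upwards [eventually_ge_atTop m₀] with m hm
      have : (m₀ : ℝ) ≤ m := by exact_mod_cast hm
      rw [plateau_eq_one (by linarith), one_mul]
  simp_rw [h1] at h2
  exact tendsto_nhds_unique h2 tendsto_const_nhds

/-- The L² isometry of the spectral measure: it turns dominated convergence of integrals into norm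
convergence of vectors. -/
theorem norm_sq_cfc_apply (T : ℋ →L[ℂ] ℋ) (ψ : ℋ) {f : ℝ → ℝ}
    (hf : Continuous f) {C : ℝ} (hC : ∀ x, |f x| ≤ C) :
    ‖cfc f T ψ‖ ^ 2 = ∫ x, f x ^ 2 ∂(spectralMeasure T ψ) := by
  have hsa : ContinuousLinearMap.adjoint (cfc f T) = cfc f T :=
    (cfc_predicate f T : IsSelfAdjoint _)
  rw [integral_spectralMeasure_of_continuous T ψ (f := fun x => f x ^ 2) (hf.pow 2) (C := C ^ 2)
    fun x => by rw [abs_pow]; gcongr; exact hC x]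
  simp_rw [pow_two (f _)]
  rw [cfc_mul f f T, mul_apply_eq_comp, ← ContinuousLinearMap.adjoint_inner_left, hsa]
  exact (inner_self_eq_norm_sq (𝕜 := ℂ) _).symm

/-- Bounded pointwise convergence of continuous functions implies strong convergence
to the Borel functional calculus of the limit. -/
theorem tendsto_cfc_borelCalculus (T : ℋ →L[ℂ] ℋ) {f : ℕ → ℝ → ℝ} {g : ℝ → ℝ}
    (hf : ∀ k, Continuous (f k)) {C : ℝ} (hC : ∀ k x, |f k x| ≤ C)
    (hg : ∀ x, Tendsto (fun k => f k x) atTop (𝓝 (g x))) (ψ : ℋ) :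
    Tendsto (fun k => cfc (f k) T ψ) atTop (𝓝 (borelCalculus T g ψ)) := by
  have hgm : Measurable g := measurable_of_tendsto_metrizable (fun k => (hf k).measurable)
    (tendsto_pi_nhds.2 hg)
  have hgC : ∀ x, |g x| ≤ C := fun x => le_of_tendsto (hg x).abs (.of_forall fun k => hC k x)
  have hcauchy : ∀ ψ, CauchySeq fun k => cfc (f k) T ψ := by
    intro ψ
    rw [cauchySeq_iff_tendsto_dist_atTop_0]
    have h0 : Tendsto (fun n : ℕ × ℕ => ∫ x, (f n.1 x - f n.2 x) ^ 2 ∂(spectralMeasure T ψ))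
        atTop (𝓝 (∫ _, (0 : ℝ) ∂(spectralMeasure T ψ))) := by
      refine tendsto_integral_filter_of_dominated_convergence (fun _ => (2 * C) ^ 2)
        (.of_forall fun n => (((hf _).sub (hf _)).pow 2).aestronglyMeasurable)
        (.of_forall fun n => .of_forall fun x => ?_) (integrable_const _) (.of_forall fun x => ?_)
      · rw [norm_pow]
        gcongr
        refine (norm_sub_le _ _).trans ?_
        linarith [hC n.1 x, hC n.2 x, Real.norm_eq_abs (f n.1 x), Real.norm_eq_abs (f n.2 x)]
      · have h1 : Tendsto (fun n : ℕ × ℕ => (f n.1 x - f n.2 x) ^ 2) atTop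
            (𝓝 ((g x - g x) ^ 2)) := by
          rw [← prod_atTop_atTop_eq]
          exact (((hg x).comp tendsto_fst).sub ((hg x).comp tendsto_snd)).pow 2
        simpa using h1
    rw [integral_zero] at h0
    have h1 := h0.sqrt
    rw [Real.sqrt_zero] at h1
    refine h1.congr fun n => ?_
    rw [← norm_sq_cfc_apply T ψ (f := fun x => f n.1 x - f n.2 x) ((hf _).sub (hf _)) (C := 2 * C)
      (fun x => (abs_sub _ _).trans (by linarith [hC n.1 x, hC n.2 x])),
      Real.sqrt_sq (norm_nonneg _), cfc_sub (f n.1) (f n.2) T, dist_eq_norm]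
    rfl
  choose G hG using fun ψ => cauchySeq_tendsto_of_complete (hcauchy ψ)
  -- The strong limit is bounded by Banach–Steinhaus. Its quadratic form is the integral of g, so
  -- uniqueness identifies it with the Borel calculus.
  set G' : ℋ →L[ℂ] ℋ := continuousLinearMapOfTendsto (fun k : ℕ => cfc (f k) T)
    (tendsto_pi_nhds.2 hG) with hG'
  have hspec : IsBorelCalculus T g G' := by
    intro ψ
    have h1 : Tendsto (fun k => ⟪ψ, cfc (f k) T ψ⟫_ℂ) atTop (𝓝 ⟪ψ, G ψ⟫_ℂ) :=
      tendsto_const_nhds.inner (hG ψ)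
    have h2 : Tendsto (fun k => ∫ x, f k x ∂(spectralMeasure T ψ)) atTop
        (𝓝 (∫ x, g x ∂(spectralMeasure T ψ))) :=
      tendsto_integral_filter_of_dominated_convergence (fun _ => C)
        (.of_forall fun k => (hf k).aestronglyMeasurable)
        (.of_forall fun k => .of_forall fun x => hC k x) (integrable_const _) (.of_forall hg)
    have h3 := (Complex.continuous_ofReal.tendsto _).comp h2
    refine tendsto_nhds_unique h1 (h3.congr fun k => ?_)
    rw [inner_apply_self_re (cfc_predicate (f k) T : IsSelfAdjoint _) ψ, Function.comp_apply,
      integral_spectralMeasure_of_continuous T ψ (hf k) (hC k)]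
  rw [(borelCalculus_spec T hgm hgC).unique hspec]
  exact hG ψ

/-- A continuous approximation of the sign function. -/
noncomputable def signApprox (k : ℕ) (x : ℝ) : ℝ := k * x / (1 + k * |x|)

theorem one_add_mul_abs_pos (k : ℕ) (x : ℝ) : 0 < 1 + k * |x| := by positivity

theorem continuous_signApprox (k : ℕ) : Continuous (signApprox k) :=
  (continuous_const.mul continuous_id).div (by fun_prop) fun x => (one_add_mul_abs_pos k x).ne'

theorem abs_signApprox_le (k : ℕ) (x : ℝ) : |signApprox k x| ≤ 1 := by
  rw [signApprox, abs_div, abs_mul, abs_of_pos (one_add_mul_abs_pos k x), Nat.abs_cast,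
    div_le_one (one_add_mul_abs_pos k x)]
  linarith

theorem tendsto_signApprox (x : ℝ) :
    Tendsto (fun k => signApprox k x) atTop (𝓝 (Real.sign x)) := by
  rcases eq_or_ne x 0 with rfl | hx
  · simp [signApprox]
  have h1 : Tendsto (fun k : ℕ => ((k : ℝ) * |x| + 1)) atTop atTop :=
    tendsto_atTop_add_const_right _ _
      (tendsto_natCast_atTop_atTop.atTop_mul_const (abs_pos.2 hx))
  have h2 : Tendsto (fun k : ℕ => Real.sign x * (1 - ((k : ℝ) * |x| + 1)⁻¹)) atTop
      (𝓝 (Real.sign x * (1 - 0))) :=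
    (tendsto_const_nhds.sub (tendsto_inv_atTop_zero.comp h1)).const_mul _
  rw [sub_zero, mul_one] at h2
  refine h2.congr fun k => ?_
  have hp := one_add_mul_abs_pos k x
  rw [add_comm] at hp
  have hs : Real.sign x * |x| = x := by
    rcases hx.lt_or_gt with h | h
    · rw [Real.sign_of_neg h, abs_of_neg h]; ring
    · rw [Real.sign_of_pos h, abs_of_pos h]; ring
  have h3 : 1 - ((k : ℝ) * |x| + 1)⁻¹ = k * |x| / (k * |x| + 1) := by
    field_simp
    ring
  rw [h3, signApprox, add_comm 1, mul_div_assoc', mul_left_comm, hs]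

theorem tendsto_cfc_signApprox (T : ℋ →L[ℂ] ℋ) (ψ : ℋ) :
    Tendsto (fun k => cfc (signApprox k) T ψ) atTop (𝓝 (borelCalculus T Real.sign ψ)) :=
  tendsto_cfc_borelCalculus T continuous_signApprox abs_signApprox_le tendsto_signApprox ψ

theorem norm_cfc_signApprox_le (T : ℋ →L[ℂ] ℋ) (k : ℕ) : ‖cfc (signApprox k) T‖ ≤ 1 :=
  norm_cfc_le zero_le_one fun x _ => abs_signApprox_le k x

theorem norm_borelCalculus_sign_le (T : ℋ →L[ℂ] ℋ) : ‖borelCalculus T Real.sign‖ ≤ 1 :=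
  ContinuousLinearMap.opNorm_le_bound _ zero_le_one fun ψ =>
    le_of_tendsto (tendsto_cfc_signApprox T ψ).norm
      (.of_forall fun k => ContinuousLinearMap.le_of_opNorm_le _ (norm_cfc_signApprox_le T k) ψ)

theorem inner_borelCalculus_sign_left (T : ℋ →L[ℂ] ℋ) (φ ψ : ℋ) :
    ⟪borelCalculus T Real.sign φ, ψ⟫_ℂ = ⟪φ, borelCalculus T Real.sign ψ⟫_ℂ := by
  refine tendsto_nhds_unique ((tendsto_cfc_signApprox T φ).inner tendsto_const_nhds)
    ((tendsto_const_nhds.inner (tendsto_cfc_signApprox T ψ)).congr fun k => ?_)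
  have hsa : IsSelfAdjoint (cfc (signApprox k) T) := cfc_predicate _ _
  rw [ContinuousLinearMap.isSelfAdjoint_iff_isSymmetric] at hsa
  exact (hsa φ ψ).symm

/-- Products of strongly convergent operators converge strongly thanks to the uniform norm bound. -/
theorem tendsto_cfc_signApprox_sq (T : ℋ →L[ℂ] ℋ) (ψ : ℋ) :
    Tendsto (fun k => cfc (signApprox k) T (cfc (signApprox k) T ψ)) atTop
      (𝓝 (borelCalculus T Real.sign (borelCalculus T Real.sign ψ))) := by
  have h1 : Tendsto (fun k => cfc (signApprox k) T
      (cfc (signApprox k) T ψ - borelCalculus T Real.sign ψ)) atTop (𝓝 0) := by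
    have h := ((tendsto_cfc_signApprox T ψ).sub_const (borelCalculus T Real.sign ψ)).norm
    rw [sub_self, norm_zero] at h
    refine squeeze_zero_norm (fun k => ?_) h
    simpa using ContinuousLinearMap.le_of_opNorm_le _ (norm_cfc_signApprox_le T k)
      (cfc (signApprox k) T ψ - borelCalculus T Real.sign ψ)
  have h2 := h1.add (tendsto_cfc_signApprox T (borelCalculus T Real.sign ψ))
  rw [zero_add] at h2
  refine h2.congr fun k => ?_
  rw [map_sub, sub_add_cancel]

theorem indicator_zero_eq_sign (x : ℝ) :
    ({0} : Set ℝ).indicator 1 x = 1 - Real.sign x * Real.sign x := by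
  rcases lt_trichotomy x 0 with h | rfl | h
  · simp [h.ne, Real.sign_of_neg h]
  · simp
  · simp [h.ne', Real.sign_of_pos h]

theorem indicator_Iio_eq_sign (x : ℝ) :
    (Set.Iio (0 : ℝ)).indicator 1 x = 2⁻¹ * (Real.sign x * Real.sign x - Real.sign x) := by
  rcases lt_trichotomy x 0 with h | rfl | h
  · simp [h, Real.sign_of_neg h]; norm_num
  · simp
  · simp [h.le, Real.sign_of_pos h]

/-- The pointwise identity χ_{0} = 1 − sgn² passes through the same approximants, so that statements
about the zero projection become statements about the sign. -/
theorem spectralProjection_zero_apply (hT : IsSelfAdjoint T) (ψ : ℋ) :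
    spectralProjection T {0} ψ = ψ - borelCalculus T Real.sign (borelCalculus T Real.sign ψ) := by
  have hc := continuous_signApprox
  have h := tendsto_cfc_borelCalculus T (f := fun k x => 1 - signApprox k x * signApprox k x)
    (g := ({0} : Set ℝ).indicator 1) (fun k => by fun_prop) (C := 1) (fun k x => ?_)
    (fun x => ?_) ψ
  · refine tendsto_nhds_unique h ((tendsto_const_nhds.sub (tendsto_cfc_signApprox_sq T ψ)).congr
      fun k => ?_)
    rw [cfc_sub (fun _ : ℝ => (1 : ℝ)) (fun x => signApprox k x * signApprox k x) T
      (by fun_prop) (by fun_prop), cfc_mul _ _ T (by fun_prop) (by fun_prop), cfc_const_one ℝ T]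
    rfl
  · have h1 := abs_le.1 (abs_signApprox_le k x)
    rw [abs_le]
    constructor <;> nlinarith
  · rw [indicator_zero_eq_sign]
    exact tendsto_const_nhds.sub ((tendsto_signApprox x).mul (tendsto_signApprox x))

theorem spectralProjection_Iio_zero_apply (T : ℋ →L[ℂ] ℋ) (ψ : ℋ) :
    spectralProjection T (Set.Iio 0) ψ = (2⁻¹ : ℝ) • (borelCalculus T Real.sign
      (borelCalculus T Real.sign ψ) - borelCalculus T Real.sign ψ) := by
  have hc := continuous_signApprox
  have h := tendsto_cfc_borelCalculus T
    (f := fun k x => 2⁻¹ * (signApprox k x * signApprox k x - signApprox k x))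
    (g := (Set.Iio (0 : ℝ)).indicator 1) (fun k => by fun_prop) (C := 1) (fun k x => ?_)
    (fun x => ?_) ψ
  · refine tendsto_nhds_unique h (((tendsto_cfc_signApprox_sq T ψ).sub
      (tendsto_cfc_signApprox T ψ)).const_smul (2⁻¹ : ℝ) |>.congr fun k => ?_)
    rw [cfc_const_mul (2⁻¹ : ℝ) (fun x => signApprox k x * signApprox k x - signApprox k x) T
      (by fun_prop), cfc_sub (fun x => signApprox k x * signApprox k x) (signApprox k) T
      (by fun_prop) (by fun_prop), cfc_mul _ _ T (by fun_prop) (by fun_prop)]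
    rfl
  · have h1 := abs_le.1 (abs_signApprox_le k x)
    rw [abs_le]
    constructor <;> nlinarith
  · rw [indicator_Iio_eq_sign]
    exact (((tendsto_signApprox x).mul (tendsto_signApprox x)).sub
      (tendsto_signApprox x)).const_mul _

theorem cfc_signApprox_mul_self (hT : IsSelfAdjoint T) (k : ℕ) :
    cfc (signApprox k) T * T = cfc (fun x => signApprox k x * x) T := by
  have hc := continuous_signApprox k
  rw [cfc_mul (signApprox k) (fun x => x) T (by fun_prop) (by fun_prop), cfc_id' ℝ T]

/-- `sgn(T) T = |T|`. -/
theorem borelCalculus_sign_apply_self (hT : IsSelfAdjoint T) (ψ : ℋ) :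
    borelCalculus T Real.sign (T ψ) = cfc (fun x : ℝ => |x|) T ψ := by
  have hc := continuous_signApprox
  refine tendsto_nhds_unique (tendsto_cfc_signApprox T (T ψ)) ?_
  rw [tendsto_iff_norm_sub_tendsto_zero]
  have h0 : Tendsto (fun k : ℕ => (1 / ((k : ℝ) + 1)) * ‖ψ‖) atTop (𝓝 (0 * ‖ψ‖)) :=
    tendsto_one_div_add_atTop_nhds_zero_nat.mul_const _
  rw [zero_mul, ← tendsto_add_atTop_iff_nat 0] at h0
  -- The error |x|/(1 + k|x|) is at most 1/k uniformly in x, but unbounded for k = 0; hence the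
  -- shift of the index.
  rw [← tendsto_add_atTop_iff_nat 1]
  refine squeeze_zero (fun k => norm_nonneg _) (fun k => ?_) h0
  have h1 : cfc (signApprox (k + 1)) T (T ψ) - cfc (fun x : ℝ => |x|) T ψ =
      cfc (fun x => signApprox (k + 1) x * x - |x|) T ψ := by
    rw [cfc_sub (fun x => signApprox (k + 1) x * x) (fun x => |x|) T (by fun_prop) (by fun_prop),
      ← cfc_signApprox_mul_self hT]
    rfl
  rw [h1]
  refine ContinuousLinearMap.le_of_opNorm_le _ (norm_cfc_le (by positivity) fun x _ => ?_) ψ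
  have hp := one_add_mul_abs_pos (k + 1) x
  have h2 : signApprox (k + 1) x * x - |x| = -(|x| / (1 + (k + 1 : ℕ) * |x|)) := by
    rw [signApprox, div_mul_eq_mul_div, mul_assoc, ← abs_mul_abs_self x]
    field_simp
    ring
  rw [h2, norm_neg, Real.norm_of_nonneg (by positivity), div_le_div_iff₀ hp (by positivity)]
  push_cast
  nlinarith [abs_nonneg x]

/-- `sgn(T)` annihilates the kernel of `T`. -/
theorem borelCalculus_sign_apply_of_apply_eq_zero (hT : IsSelfAdjoint T) {ψ : ℋ} (h : T ψ = 0) :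
    borelCalculus T Real.sign ψ = 0 := by
  refine tendsto_nhds_unique (tendsto_cfc_signApprox T ψ) (tendsto_const_nhds.congr fun k => ?_)
  -- Each approximant is a continuous function times x, so a factor T splits off on the right and
  -- meets ψ first.
  have hc : Continuous fun x : ℝ => (k : ℝ) / (1 + k * |x|) :=
    continuous_const.div (by fun_prop) fun x => (one_add_mul_abs_pos k x).ne'
  have h1 : cfc (signApprox k) T = cfc (fun x => (k : ℝ) / (1 + k * |x|) * x) T :=
    cfc_congr fun x _ => by simp only [signApprox]; ring
  rw [h1, cfc_mul (fun x : ℝ => (k : ℝ) / (1 + k * |x|)) (fun x => x) T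
    hc.continuousOn (by fun_prop), cfc_id' ℝ T, mul_apply_eq_comp, h, map_zero]

/-- `χ_{0}(T)` maps into the kernel of `T`. -/
theorem apply_spectralProjection_zero (hT : IsSelfAdjoint T) (ψ : ℋ) :
    T (spectralProjection T {0} ψ) = 0 := by
  have hc := continuous_signApprox
  have h1 : Tendsto (fun k => T (ψ - cfc (signApprox k) T (cfc (signApprox k) T ψ))) atTop
      (𝓝 (T (spectralProjection T {0} ψ))) := by
    rw [spectralProjection_zero_apply hT]
    exact (T.continuous.tendsto _).comp (tendsto_const_nhds.sub (tendsto_cfc_signApprox_sq T ψ))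
  refine tendsto_nhds_unique h1 ?_
  have h0 : Tendsto (fun k : ℕ => (2 * (1 / ((k : ℝ) + 1))) * ‖ψ‖) atTop (𝓝 (2 * 0 * ‖ψ‖)) :=
    (tendsto_one_div_add_atTop_nhds_zero_nat.const_mul 2).mul_const _
  rw [mul_zero, zero_mul, ← tendsto_add_atTop_iff_nat 0] at h0
  rw [← tendsto_add_atTop_iff_nat 1]
  refine squeeze_zero_norm (fun k => ?_) h0
  have h2 : T (ψ - cfc (signApprox (k + 1)) T (cfc (signApprox (k + 1)) T ψ)) =
      cfc (fun x => x * (1 - signApprox (k + 1) x * signApprox (k + 1) x)) T ψ := by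
    rw [cfc_mul (fun x : ℝ => x) (fun x => 1 - signApprox (k + 1) x * signApprox (k + 1) x) T
      (by fun_prop) (by fun_prop), cfc_sub (fun _ : ℝ => (1 : ℝ))
      (fun x => signApprox (k + 1) x * signApprox (k + 1) x) T
      (by fun_prop) (by fun_prop), cfc_mul _ _ T (by fun_prop) (by fun_prop), cfc_const_one ℝ T,
      cfc_id' ℝ T]
    rfl
  rw [h2]
  refine ContinuousLinearMap.le_of_opNorm_le _ (norm_cfc_le (by positivity) fun x _ => ?_) ψ
  have hp := one_add_mul_abs_pos (k + 1) x
  have hk : (0 : ℝ) ≤ (k + 1 : ℕ) * |x| := by positivity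
  -- Multiplied by |x|, this is at most 2/(k + 1) for every x, so T times the approximants of the
  -- zero projection tends to 0 in norm.
  have h3 : 1 - signApprox (k + 1) x * signApprox (k + 1) x =
      (1 + 2 * ((k + 1 : ℕ) * |x|)) / (1 + (k + 1 : ℕ) * |x|) ^ 2 := by
    rw [signApprox, div_mul_div_comm, mul_mul_mul_comm, ← abs_mul_abs_self x]
    field_simp
    ring
  have h4 : 0 ≤ (1 + 2 * ((k + 1 : ℕ) * |x|)) / (1 + (k + 1 : ℕ) * |x|) ^ 2 := by positivity
  rw [h3, norm_mul, Real.norm_of_nonneg h4, Real.norm_eq_abs, mul_div_assoc', mul_one_div,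
    div_le_div_iff₀ (by positivity) (by positivity)]
  push_cast at hk ⊢
  nlinarith [abs_nonneg x]

end BorelCalculus

/-! ### Strong convergence of functions of compressions; chiral symmetry of the sign. -/

section StrongConvergence
open Filter Topology
variable {ℋ : Type*} [NormedAddCommGroup ℋ] [InnerProductSpace ℂ ℋ]

theorem tendsto_apply_of_strong {α : Type*} {l : Filter α} {X : α → ℋ →L[ℂ] ℋ} {Y : ℋ →L[ℂ] ℋ}
    {C : ℝ} (hX : ∀ a, ‖X a‖ ≤ C) (h : ∀ ψ, Tendsto (fun a => X a ψ) l (𝓝 (Y ψ)))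
    {φ : α → ℋ} {ψ : ℋ} (hφ : Tendsto φ l (𝓝 ψ)) :
    Tendsto (fun a => X a (φ a)) l (𝓝 (Y ψ)) := by
  have h1 : Tendsto (fun a => X a (φ a - ψ)) l (𝓝 0) := by
    have h0 := ((hφ.sub_const ψ).norm.const_mul C)
    rw [sub_self, norm_zero, mul_zero] at h0
    exact squeeze_zero_norm (fun a => (X a).le_of_opNorm_le (hX a) _) h0
  have h2 := h1.add (h ψ)
  rw [zero_add] at h2
  refine h2.congr fun a => ?_
  rw [map_sub, sub_add_cancel]

/-- Uniformly bounded operators that converge on a total set converge strongly. -/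
theorem tendsto_of_tendsto_on_total {α : Type*} {l : Filter α} {X : α → ℋ →L[ℂ] ℋ}
    {Y : ℋ →L[ℂ] ℋ} (hX : ∀ a, ‖X a‖ ≤ 1) (hY : ‖Y‖ ≤ 1) {D : Set ℋ}
    (hD : (Submodule.span ℂ D).topologicalClosure = ⊤)
    (h : ∀ ψ ∈ D, Tendsto (fun a => X a ψ) l (𝓝 (Y ψ))) (ψ : ℋ) :
    Tendsto (fun a => X a ψ) l (𝓝 (Y ψ)) := by
  have hspan : ∀ ψ ∈ Submodule.span ℂ D, Tendsto (fun a => X a ψ) l (𝓝 (Y ψ)) := by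
    intro ψ hψ
    induction hψ using Submodule.span_induction with
    | mem x hx => exact h x hx
    | zero => simpa using tendsto_const_nhds
    | add x y _ _ hx hy => simpa using hx.add hy
    | smul c x _ hx => simpa using hx.const_smul c
  rw [Metric.tendsto_nhds]
  intro ε hε
  have hmem : ψ ∈ closure (Submodule.span ℂ D : Set ℋ) := by
    rw [← Submodule.topologicalClosure_coe, hD]; trivial
  obtain ⟨φ, hφ, hd⟩ := Metric.mem_closure_iff.1 hmem (ε / 3) (by positivity)
  filter_upwards [Metric.tendsto_nhds.1 (hspan φ hφ) (ε / 3) (by positivity)] with a ha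
  have h1 : ∀ Z : ℋ →L[ℂ] ℋ, ‖Z‖ ≤ 1 → dist (Z ψ) (Z φ) < ε / 3 := fun Z hZ => by
    rw [dist_eq_norm, ← map_sub]
    rw [dist_eq_norm] at hd
    have := Z.le_of_opNorm_le hZ (ψ - φ)
    linarith
  have h2 := h1 _ (hX a)
  have h3 := h1 _ hY
  rw [dist_comm] at h3
  linarith [dist_triangle4 (X a ψ) (X a φ) (Y φ) (Y ψ)]

variable {α : Type*} {l : Filter α} {𝓔 : α → Type*} [∀ a, NormedAddCommGroup (𝓔 a)]
  [∀ a, InnerProductSpace ℂ (𝓔 a)]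
  {J : ∀ a, 𝓔 a →L[ℂ] ℋ} {R : ∀ a, ℋ →L[ℂ] 𝓔 a}

theorem norm_comp_comp_le (hJ : ∀ a, ‖J a‖ ≤ 1) (hR : ∀ a, ‖R a‖ ≤ 1) (a : α)
    (X : 𝓔 a →L[ℂ] 𝓔 a) : ‖J a ∘L X ∘L R a‖ ≤ ‖X‖ :=
  calc ‖J a ∘L X ∘L R a‖ ≤ ‖J a‖ * (‖X‖ * ‖R a‖) :=
        (ContinuousLinearMap.opNorm_comp_le _ _).trans (by
          gcongr; exact ContinuousLinearMap.opNorm_comp_le _ _)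
    _ ≤ 1 * (‖X‖ * 1) := by gcongr; exacts [hJ a, hR a]
    _ = ‖X‖ := by ring

/-- J and R model inclusion of and restriction to a half-line; only contractivity and JR → 1
strongly are needed. The induction uses J(RTJ)^(m+1)R = (JR) T (J(RTJ)^m R). -/
theorem tendsto_compression_pow (T : ℋ →L[ℂ] ℋ) (hJ : ∀ a, ‖J a‖ ≤ 1) (hR : ∀ a, ‖R a‖ ≤ 1)
    (hJR : ∀ ψ, Tendsto (fun a => J a (R a ψ)) l (𝓝 ψ)) (m : ℕ) (ψ : ℋ) :
    Tendsto (fun a => J a (((R a ∘L T ∘L J a) ^ m) (R a ψ))) l (𝓝 ((T ^ m) ψ)) := by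
  induction m with
  | zero => exact hJR ψ
  | succ m ih =>
    have h1 := (T.continuous.tendsto _).comp ih
    have hb : ∀ a, ‖J a ∘L R a‖ ≤ 1 := fun a =>
      (ContinuousLinearMap.opNorm_comp_le _ _).trans
        (mul_le_one₀ (hJ a) (norm_nonneg _) (hR a))
    have h2 := tendsto_apply_of_strong (Y := 1) hb hJR h1
    refine Tendsto.congr (fun a => ?_) (h2.trans_eq ?_)
    · rw [pow_succ']; rfl
    · rw [pow_succ']; rfl

theorem tendsto_compression_aeval (T : ℋ →L[ℂ] ℋ) (hJ : ∀ a, ‖J a‖ ≤ 1) (hR : ∀ a, ‖R a‖ ≤ 1)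
    (hJR : ∀ ψ, Tendsto (fun a => J a (R a ψ)) l (𝓝 ψ)) (p : Polynomial ℝ) (ψ : ℋ) :
    Tendsto (fun a => J a (Polynomial.aeval (R a ∘L T ∘L J a) p (R a ψ))) l
      (𝓝 (Polynomial.aeval T p ψ)) := by
  induction p using Polynomial.induction_on' with
  | add p q hp hq => simpa using hp.add hq
  | monomial m c =>
    have h := (tendsto_compression_pow T hJ hR hJR m ψ).const_smul c
    have hr : ∀ a φ, J a (c • φ) = c • J a φ := fun a φ => by
      rw [← Complex.coe_smul, map_smul, Complex.coe_smul]
    simp only [Polynomial.aeval_monomial, ← Algebra.smul_def]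
    simpa [hr] using h

variable [CompleteSpace ℋ]

/-- An operator anticommuting with `T` anticommutes with `sgn(T)`. -/
theorem borelCalculus_sign_anticomm {T Γ : ℋ →L[ℂ] ℋ} (hT : IsSelfAdjoint T)
    (h : Γ * T = -(T * Γ)) (ψ : ℋ) :
    Γ (borelCalculus T Real.sign ψ) = -(borelCalculus T Real.sign (Γ ψ)) := by
  have key : ∀ k : ℕ, Γ * cfc (signApprox k) T = -(cfc (signApprox k) T * Γ) := by
    intro k
    have hpos : ∀ y : ℝ, 0 < 1 + (k : ℝ) * √|y| := fun y => by positivity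
    have hg : Continuous fun y : ℝ => (k : ℝ) / (1 + k * √|y|) :=
      continuous_const.div (by fun_prop) fun y => (hpos y).ne'
    -- An odd function of T is a function of T² times T. The first factor commutes with Γ because T²
    -- does; only the last one changes sign.
    have h1 : cfc (signApprox k) T = cfc (fun y : ℝ => (k : ℝ) / (1 + k * √|y|)) (T * T) * T := by
      have h2 : T * T = cfc (fun x : ℝ => x * x) T := by
        rw [cfc_mul (fun x : ℝ => x) (fun x : ℝ => x) T, cfc_id' ℝ T]
      have h3 : cfc (signApprox k) T = cfc (fun x => (k : ℝ) / (1 + k * √|x * x|) * x) T :=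
        cfc_congr fun x _ => by
          simp only [signApprox]
          rw [abs_mul_self, ← abs_mul_abs_self, Real.sqrt_mul_self (abs_nonneg x)]
          ring
      rw [h3, cfc_mul (fun x : ℝ => (k : ℝ) / (1 + k * √|x * x|)) (fun x => x) T
        (hg.comp (by fun_prop : Continuous fun x : ℝ => x * x)).continuousOn (by fun_prop),
        cfc_id' ℝ T, h2,
        cfc_comp' (fun y : ℝ => (k : ℝ) / (1 + k * √|y|)) (fun x => x * x) T hg.continuousOn
          (by fun_prop)]
    have hc : Commute (T * T) Γ := by
      have : Γ * (T * T) = T * T * Γ := by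
        rw [← mul_assoc, h, neg_mul, mul_assoc, h, mul_neg, neg_neg, mul_assoc]
      exact this.symm
    have hc2 := hc.cfc_real (fun y : ℝ => (k : ℝ) / (1 + k * √|y|))
    rw [h1, ← mul_assoc, ← hc2.eq, mul_assoc, h, mul_neg, mul_assoc]
  refine tendsto_nhds_unique ((Γ.continuous.tendsto _).comp (tendsto_cfc_signApprox T ψ))
    ((tendsto_cfc_signApprox T (Γ ψ)).neg.congr fun k => ?_)
  exact (congrArg (fun Z : ℋ →L[ℂ] ℋ => Z ψ) (key k)).symm

/-- With a chiral symmetry, `sgn(T)` is determined by the Fermi projection. -/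
theorem borelCalculus_sign_eq_spectralProjection {T Γ : ℋ →L[ℂ] ℋ} (hT : IsSelfAdjoint T)
    (h : Γ * T = -(T * Γ)) (hΓ : Γ * Γ = 1) (ψ : ℋ) :
    borelCalculus T Real.sign ψ = Γ (spectralProjection T (Set.Iio 0) (Γ ψ)) -
      spectralProjection T (Set.Iio 0) ψ := by
  have hΓ' : ∀ φ, Γ (Γ φ) = φ := fun φ => congrArg (fun Z : ℋ →L[ℂ] ℋ => Z φ) hΓ
  have ha := borelCalculus_sign_anticomm hT h
  have ha' : ∀ φ, borelCalculus T Real.sign (Γ φ) = -(Γ (borelCalculus T Real.sign φ)) :=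
    fun φ => by rw [ha, neg_neg]
  have hr : ∀ (c : ℝ) φ, Γ (c • φ) = c • Γ φ := fun c φ => by
    rw [← Complex.coe_smul, map_smul, Complex.coe_smul]
  -- With s = sgn(T), the Fermi projection is (s² − s)/2 and its conjugate by Γ is (s² + s)/2. Their
  -- difference is s without any assumption that s² = 1.
  rw [spectralProjection_Iio_zero_apply, spectralProjection_Iio_zero_apply, ha', hr, map_sub,
    map_neg, map_neg, ha', map_neg, map_neg, hΓ', hΓ', neg_neg, sub_neg_eq_add, smul_add, smul_sub]
  module

/-- A self-adjoint injective operator has dense range. -/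
theorem topologicalClosure_range_eq_top {T : ℋ →L[ℂ] ℋ} (hT : IsSelfAdjoint T)
    (h : ∀ ψ, T ψ = 0 → ψ = 0) :
    (Submodule.span ℂ (Set.range T)).topologicalClosure = ⊤ := by
  rw [Submodule.topologicalClosure_eq_top_iff, Submodule.eq_bot_iff]
  intro ψ hψ
  refine h ψ (ext_inner_left ℂ fun φ => ?_)
  rw [ContinuousLinearMap.isSelfAdjoint_iff_isSymmetric] at hT
  rw [inner_zero_right]
  exact (hT φ ψ).symm.trans (Submodule.inner_right_of_mem_orthogonal
    (Submodule.subset_span (Set.mem_range_self φ)) hψ)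

/-- `sgn(T)² = 1` if `T` is injective. -/
theorem borelCalculus_sign_sign {T : ℋ →L[ℂ] ℋ} (hT : IsSelfAdjoint T)
    (h : ∀ ψ, T ψ = 0 → ψ = 0) (ψ : ℋ) :
    borelCalculus T Real.sign (borelCalculus T Real.sign ψ) = ψ := by
  have h1 := h _ (apply_spectralProjection_zero hT ψ)
  rw [spectralProjection_zero_apply hT, sub_eq_zero] at h1
  exact h1.symm

/-- The estimate depends on A only through the norm bound, so one Weierstrass polynomial serves T
and all its compressions. -/
theorem norm_cfc_sub_aeval_le {A : ℋ →L[ℂ] ℋ} (hA : IsSelfAdjoint A) {M δ : ℝ} (hAM : ‖A‖ ≤ M)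
    {f : ℝ → ℝ} (hf : Continuous f) {p : Polynomial ℝ} (hδ : 0 ≤ δ)
    (hp : ∀ x ∈ Set.Icc (-M) M, |p.eval x - f x| < δ) :
    ‖cfc f A - Polynomial.aeval A p‖ ≤ δ := by
  have hpc : Continuous fun x => p.eval x := p.continuous
  rw [← cfc_polynomial p A, ← cfc_sub f p.eval A (by fun_prop) (by fun_prop)]
  refine norm_cfc_le hδ fun x hx => ?_
  rw [Real.norm_eq_abs, abs_sub_comm]
  refine (hp x (abs_le.1 ((abs_le_of_mem_spectrum hx).trans ?_))).le
  exact (mul_le_of_le_one_right (norm_nonneg _) ContinuousLinearMap.norm_id_le).trans hAM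

variable [∀ a, CompleteSpace (𝓔 a)]

/-- Strong convergence of the continuous functional calculus of compressions. -/
theorem tendsto_compression_cfc {T : ℋ →L[ℂ] ℋ} (hT : IsSelfAdjoint T) (hJ : ∀ a, ‖J a‖ ≤ 1)
    (hR : ∀ a, ‖R a‖ ≤ 1) (hJR : ∀ ψ, Tendsto (fun a => J a (R a ψ)) l (𝓝 ψ))
    (hTa : ∀ a, IsSelfAdjoint (R a ∘L T ∘L J a)) {f : ℝ → ℝ} (hf : Continuous f) (ψ : ℋ) :
    Tendsto (fun a => J a (cfc f (R a ∘L T ∘L J a) (R a ψ))) l (𝓝 (cfc f T ψ)) := by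
  rw [Metric.tendsto_nhds]
  intro ε hε
  set δ := ε / (3 * (‖ψ‖ + 1)) with hδ
  have hδ0 : 0 < δ := by positivity
  have hδψ : δ * ‖ψ‖ < ε / 3 := by
    rw [hδ, div_mul_eq_mul_div, div_lt_div_iff₀ (by positivity) (by positivity)]
    nlinarith
  obtain ⟨p, hp⟩ := exists_polynomial_near_of_continuousOn (-‖T‖) ‖T‖ f hf.continuousOn δ hδ0
  filter_upwards [Metric.tendsto_nhds.1 (tendsto_compression_aeval T hJ hR hJR p ψ) (ε / 3)
    (by positivity)] with a ha
  have hnorm : ‖R a ∘L T ∘L J a‖ ≤ ‖T‖ :=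
    calc ‖R a ∘L T ∘L J a‖ ≤ ‖R a‖ * (‖T‖ * ‖J a‖) :=
          (ContinuousLinearMap.opNorm_comp_le _ _).trans (by
            gcongr; exact ContinuousLinearMap.opNorm_comp_le _ _)
      _ ≤ 1 * (‖T‖ * 1) := by gcongr; exacts [hR a, hJ a]
      _ = ‖T‖ := by ring
  have h1 : dist (J a (cfc f (R a ∘L T ∘L J a) (R a ψ)))
      (J a (Polynomial.aeval (R a ∘L T ∘L J a) p (R a ψ))) < ε / 3 := by
    rw [dist_eq_norm, ← map_sub]
    refine lt_of_le_of_lt ?_ hδψ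
    exact (J a ∘L (cfc f (R a ∘L T ∘L J a) - Polynomial.aeval (R a ∘L T ∘L J a) p) ∘L
      R a).le_of_opNorm_le ((norm_comp_comp_le hJ hR a _).trans
        (norm_cfc_sub_aeval_le (hTa a) hnorm hf hδ0.le hp)) ψ
  have h2 : dist (Polynomial.aeval T p ψ) (cfc f T ψ) < ε / 3 := by
    rw [dist_comm, dist_eq_norm]
    refine lt_of_le_of_lt ?_ hδψ
    exact (cfc f T - Polynomial.aeval T p).le_of_opNorm_le
      (norm_cfc_sub_aeval_le hT le_rfl hf hδ0.le hp) ψ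
  linarith [dist_triangle4 (J a (cfc f (R a ∘L T ∘L J a) (R a ψ)))
    (J a (Polynomial.aeval (R a ∘L T ∘L J a) p (R a ψ))) (Polynomial.aeval T p ψ) (cfc f T ψ)]

/-- Strong convergence of the sign of compressions of an injective operator. -/
theorem tendsto_compression_sign {T : ℋ →L[ℂ] ℋ} (hT : IsSelfAdjoint T)
    (h0 : ∀ ψ, T ψ = 0 → ψ = 0) (hJ : ∀ a, ‖J a‖ ≤ 1)
    (hR : ∀ a, ‖R a‖ ≤ 1) (hJR : ∀ ψ, Tendsto (fun a => J a (R a ψ)) l (𝓝 ψ))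
    (hTa : ∀ a, IsSelfAdjoint (R a ∘L T ∘L J a)) (ψ : ℋ) :
    Tendsto (fun a => J a (borelCalculus (R a ∘L T ∘L J a) Real.sign (R a ψ))) l
      (𝓝 (borelCalculus T Real.sign ψ)) := by
  set X : α → ℋ →L[ℂ] ℋ := fun a => J a ∘L borelCalculus (R a ∘L T ∘L J a) Real.sign ∘L R a
  have hX : ∀ a, ‖X a‖ ≤ 1 := fun a =>
    (norm_comp_comp_le hJ hR a _).trans (norm_borelCalculus_sign_le _)
  -- The sign is discontinuous at 0, so it cannot be approximated directly. Injectivity of T makes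
  -- its range dense, and on the range sgn(T)T = |T| is continuous in T.
  refine tendsto_of_tendsto_on_total hX (norm_borelCalculus_sign_le T)
    (topologicalClosure_range_eq_top hT h0) ?_ ψ
  rintro _ ⟨φ, rfl⟩
  rw [borelCalculus_sign_apply_self hT]
  have h1 := tendsto_compression_cfc hT hJ hR hJR hTa continuous_abs φ
  -- Inserting JR splits X_a Tφ into this vanishing error and J|RTJ|Rφ, which is governed by `h1`.
  have h2 : Tendsto (fun a => X a (T (φ - J a (R a φ)))) l (𝓝 0) := by
    have h3 : Tendsto (fun a => T (φ - J a (R a φ))) l (𝓝 0) := by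
      have h4 := (T.continuous.tendsto _).comp ((hJR φ).const_sub φ)
      simpa [Function.comp_def] using h4
    refine squeeze_zero_norm (fun a => ?_) (by simpa using h3.norm)
    simpa using (X a).le_of_opNorm_le (hX a) (T (φ - J a (R a φ)))
  have h5 := h2.add h1
  rw [zero_add] at h5
  refine h5.congr fun a => ?_
  rw [← borelCalculus_sign_apply_self (hTa a), map_sub, map_sub]
  exact sub_add_cancel _ _

end StrongConvergence

/-! ### The site basis, and decay of the matrix elements of the sign. -/

section Sites
open Filter Topology

theorem chirality_mul_self (K : Type*) [NormedAddCommGroup K] [InnerProductSpace ℂ K] :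
    chirality K * chirality K = 1 := by
  refine ContinuousLinearMap.ext fun ψ => ?_
  simp only [mul_apply_eq_comp, chirality, blockOp_apply]
  simp
  rfl

theorem chirality_mul_chiralHamiltonian {K : Type*} [NormedAddCommGroup K]
    [InnerProductSpace ℂ K] [CompleteSpace K] (S : K →L[ℂ] K) :
    chirality K * chiralHamiltonian S = -(chiralHamiltonian S * chirality K) :=
  eq_neg_of_add_eq_zero_right (chiralHamiltonian_anticomm S)

theorem inner_chirality_left {K : Type*} [NormedAddCommGroup K] [InnerProductSpace ℂ K]
    (φ ψ : Dimer K) : ⟪chirality K φ, ψ⟫_ℂ = ⟪φ, chirality K ψ⟫_ℂ := by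
  simp [chirality, blockOp_apply, WithLp.prod_inner_apply]

variable {N : ℕ} {X : Type}

/-- The standard basis of the internal space of a dimer. -/
noncomputable def internalVec (t : Bool × Fin N) : Dimer (Internal N) :=
  WithLp.toLp 2 (bif t.1 then EuclideanSpace.single t.2 1 else 0,
    bif t.1 then 0 else EuclideanSpace.single t.2 1)

/-- The canonical basis vectors of `ℓ²(X, ℂ^N) ⊗ ℂ²`. -/
noncomputable def siteVec (p : X × Bool × Fin N) : Dimer (Ell X N) :=
  siteEmbedding p.1 (internalVec p.2)

/-- The canonical coordinates on `ℓ²(X, ℂ^N) ⊗ ℂ²`. -/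
def siteCoord (p : X × Bool × Fin N) (ψ : Dimer (Ell X N)) : ℂ :=
  bif p.2.1 then ψ.fst p.1 p.2.2 else ψ.snd p.1 p.2.2

/-- The eigenvalue of the chiral symmetry. -/
def chiralSign (s : Bool) : ℝ := bif s then 1 else -1

theorem inner_siteEmbedding (x : X) (v : Dimer (Internal N)) (ψ : Dimer (Ell X N)) :
    ⟪siteEmbedding x v, ψ⟫_ℂ = ⟪v.fst, ψ.fst x⟫_ℂ + ⟪v.snd, ψ.snd x⟫_ℂ := by
  classical
  simp only [siteEmbedding, blockOp_apply, WithLp.prod_inner_apply, zero_apply, add_zero, zero_add]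
  exact congrArg₂ (· + ·) (lp.inner_single_left (𝕜 := ℂ) (G := fun _ : X => Internal N) x v.fst _)
    (lp.inner_single_left (𝕜 := ℂ) (G := fun _ : X => Internal N) x v.snd _)

theorem inner_siteVec (p : X × Bool × Fin N) (ψ : Dimer (Ell X N)) :
    ⟪siteVec p, ψ⟫_ℂ = siteCoord p ψ := by
  obtain ⟨x, s, i⟩ := p
  rw [siteVec, inner_siteEmbedding, siteCoord]
  cases s <;> simp [internalVec, EuclideanSpace.inner_single_left]

theorem siteCoord_ext {φ ψ : Dimer (Ell X N)} (h : ∀ p, siteCoord p φ = siteCoord p ψ) :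
    φ = ψ := by
  refine WithLp.ofLp_injective 2 (Prod.ext (lp.ext (funext fun x => ?_))
    (lp.ext (funext fun x => ?_)))
  · exact PiLp.ext fun i => h (x, true, i)
  · exact PiLp.ext fun i => h (x, false, i)

theorem siteCoord_siteEmbedding [DecidableEq X] (p : X × Bool × Fin N) (x : X)
    (v : Dimer (Internal N)) : siteCoord p (siteEmbedding x v) =
      if p.1 = x then (bif p.2.1 then v.fst p.2.2 else v.snd p.2.2) else 0 := by
  obtain ⟨y, s, i⟩ := p
  simp only [siteEmbedding, blockOp_apply, siteCoord]
  cases s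
  · simp only [cond_false, zero_apply, zero_add, lp.singleContinuousLinearMap_apply,
      lp.single_apply, Pi.single_apply, WithLp.toLp_snd]
    split_ifs <;> rfl
  · simp only [cond_true, zero_apply, add_zero, lp.singleContinuousLinearMap_apply,
      lp.single_apply, Pi.single_apply, WithLp.toLp_fst]
    split_ifs <;> rfl

theorem siteCoord_siteVec [DecidableEq X] (p q : X × Bool × Fin N) :
    siteCoord p (siteVec q) = if p = q then 1 else 0 := by
  obtain ⟨x, s, i⟩ := p
  obtain ⟨y, t, j⟩ := q
  rw [siteVec, siteCoord_siteEmbedding]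
  by_cases hx : x = y
  · subst hx
    cases s <;> cases t <;> simp [internalVec]
  · simp [hx]

theorem orthonormal_siteVec : Orthonormal ℂ (siteVec : X × Bool × Fin N → Dimer (Ell X N)) := by
  classical
  rw [orthonormal_iff_ite]
  intro p q
  rw [inner_siteVec, siteCoord_siteVec]

/-- The canonical Hilbert basis of `ℓ²(X, ℂ^N) ⊗ ℂ²`. -/
noncomputable def siteBasis (X : Type) (N : ℕ) :
    HilbertBasis (X × Bool × Fin N) ℂ (Dimer (Ell X N)) :=
  HilbertBasis.mkOfOrthogonalEqBot orthonormal_siteVec (by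
    rw [Submodule.eq_bot_iff]
    intro ψ hψ
    refine siteCoord_ext fun p => ?_
    rw [← inner_siteVec, ← inner_siteVec, inner_zero_right]
    exact Submodule.inner_right_of_mem_orthogonal (Submodule.subset_span (Set.mem_range_self p)) hψ)

theorem siteBasis_apply (p : X × Bool × Fin N) : siteBasis X N p = siteVec p := by
  simp [siteBasis]

theorem chirality_siteVec (p : X × Bool × Fin N) :
    chirality (Ell X N) (siteVec p) = (chiralSign p.2.1 : ℂ) • siteVec p := by
  refine siteCoord_ext fun q => ?_
  rw [← inner_siteVec, ← inner_siteVec, inner_smul_right, ← inner_chirality_left]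
  classical
  rw [inner_siteVec q, siteCoord_siteVec]
  split_ifs with h
  · subst h
    rw [inner_chirality_left, inner_siteVec]
    have h1 := siteCoord_siteVec q q
    obtain ⟨x, s, i⟩ := q
    cases s
    · simp only [siteCoord, cond_false, if_true] at h1
      simp [siteCoord, chirality, blockOp_apply, chiralSign, h1]
    · simp only [siteCoord, cond_true, if_true] at h1
      simp [siteCoord, chirality, blockOp_apply, chiralSign, h1]
  · have h1 := siteCoord_siteVec q p
    rw [if_neg h] at h1
    rw [inner_chirality_left, inner_siteVec, mul_zero]
    obtain ⟨x, s, i⟩ := q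
    cases s
    · simp only [siteCoord, cond_false] at h1
      simp [siteCoord, chirality, blockOp_apply, h1]
    · simp only [siteCoord, cond_true] at h1
      simp [siteCoord, chirality, blockOp_apply, h1]

theorem switchOp_siteVec {Λ : ℤ → ℝ} (hΛ : IsSwitch Λ) (p : ℤ × Bool × Fin N) :
    switchOp N hΛ (siteVec p) = (Λ p.1 : ℂ) • siteVec p := by
  refine siteCoord_ext fun q => ?_
  have h0 : siteCoord q (switchOp N hΛ (siteVec p)) = Λ q.1 * siteCoord q (siteVec p) := by
    obtain ⟨x, s, i⟩ := q
    cases s <;> simp [siteCoord, switchOp, blockOp_apply, hop_apply]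
  have h1 : siteCoord q ((Λ p.1 : ℂ) • siteVec p) = Λ p.1 * siteCoord q (siteVec p) := by
    rw [← inner_siteVec, ← inner_siteVec, inner_smul_right]
  rw [h0, h1, siteCoord_siteVec]
  split_ifs with h
  · rw [h]
  · simp

theorem norm_internalVec (t : Bool × Fin N) : ‖internalVec t‖ = 1 := by
  obtain ⟨s, i⟩ := t
  rw [WithLp.prod_norm_eq_of_L2]
  cases s <;> simp [internalVec]

theorem norm_inner_siteVec_le (T : Dimer (Ell X N) →L[ℂ] Dimer (Ell X N))
    (p q : X × Bool × Fin N) : ‖⟪siteVec p, T (siteVec q)⟫_ℂ‖ ≤ ‖kernel T p.1 q.1‖ := by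
  have h : ⟪siteVec p, T (siteVec q)⟫_ℂ =
      ⟪internalVec p.2, kernel T p.1 q.1 (internalVec q.2)⟫_ℂ := by
    rw [kernel, ContinuousLinearMap.comp_apply, ContinuousLinearMap.adjoint_inner_right]
    rfl
  rw [h]
  refine (norm_inner_le_norm _ _).trans ?_
  rw [norm_internalVec, one_mul]
  simpa [norm_internalVec] using (kernel T p.1 q.1).le_opNorm (internalVec q.2)

/-- The pointwise bound contained in the mobility gap condition. -/
theorem norm_kernel_le_of_decaySum_le {pos : X → ℤ}
    {P : Dimer (Ell X N) →L[ℂ] Dimer (Ell X N)} {μ ν C : ℝ}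
    (h : decaySum pos P μ ν ≤ ENNReal.ofReal C) (x y : X) :
    ‖kernel P x y‖ ≤
      max C 0 * ((1 + |(pos x : ℝ)|) ^ ν * Real.exp (-(μ * |(pos x : ℝ) - pos y|))) := by
  have hp : 0 < 1 + |(pos x : ℝ)| := by positivity
  set w := (1 + |(pos x : ℝ)|) ^ (-ν) * Real.exp (μ * |(pos x : ℝ) - pos y|) with hw
  have hw0 : 0 < w := by positivity
  -- A single term of a nonnegative series is bounded by its sum. Only this pointwise consequence of
  -- the gap condition is kept.
  have h1 : ENNReal.ofReal ‖kernel P x y‖ * ENNReal.ofReal w ≤ ENNReal.ofReal C :=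
    calc _ ≤ traceNorm (kernel P x y) * ENNReal.ofReal w := by
          gcongr; exact ofReal_norm_le_traceNorm _
      _ ≤ _ := ENNReal.le_tsum (f := fun y => traceNorm (kernel P x y) *
            ENNReal.ofReal ((1 + |(pos x : ℝ)|) ^ (-ν) * Real.exp (μ * |(pos x : ℝ) - pos y|))) y
      _ ≤ _ := ENNReal.le_tsum (f := fun x => ∑' y, traceNorm (kernel P x y) *
            ENNReal.ofReal ((1 + |(pos x : ℝ)|) ^ (-ν) * Real.exp (μ * |(pos x : ℝ) - pos y|))) x
      _ ≤ _ := h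
  rw [← ENNReal.ofReal_mul (norm_nonneg _)] at h1
  have h2 : ‖kernel P x y‖ * w ≤ max C 0 := by
    have := (ENNReal.ofReal_le_ofReal_iff' (q := C)).1 h1
    rcases this with h | h
    · exact h.trans (le_max_left _ _)
    · exact h.trans (le_max_right _ _)
  have h3 : w * ((1 + |(pos x : ℝ)|) ^ ν * Real.exp (-(μ * |(pos x : ℝ) - pos y|))) = 1 := by
    rw [hw, mul_mul_mul_comm, ← Real.rpow_add hp, ← Real.exp_add]
    simp
  calc ‖kernel P x y‖ = ‖kernel P x y‖ * w *
        ((1 + |(pos x : ℝ)|) ^ ν * Real.exp (-(μ * |(pos x : ℝ) - pos y|))) := by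
          rw [mul_assoc, h3, mul_one]
    _ ≤ _ := by gcongr

/-- The matrix elements of the sign of a chiral Hamiltonian with a mobility gap. -/
theorem norm_inner_sign_le {pos : X → ℤ} {S : Ell X N →L[ℂ] Ell X N} {μ ν C : ℝ}
    (h : decaySum pos (spectralProjection (chiralHamiltonian S) (Set.Iio 0)) μ ν ≤
      ENNReal.ofReal C) (p q : X × Bool × Fin N) :
    ‖⟪siteVec p, borelCalculus (chiralHamiltonian S) Real.sign (siteVec q)⟫_ℂ‖ ≤
      2 * (max C 0 * ((1 + |(pos p.1 : ℝ)|) ^ ν *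
        Real.exp (-(μ * |(pos p.1 : ℝ) - pos q.1|)))) := by
  set P := spectralProjection (chiralHamiltonian S) (Set.Iio 0)
  have hk := (norm_inner_siteVec_le P p q).trans (norm_kernel_le_of_decaySum_le h p.1 q.1)
  -- In Σ = ΠPΠ − P the chirality is diagonal with entries ±1 in the site basis, so both terms obey
  -- the bound for P; hence the factor 2.
  rw [borelCalculus_sign_eq_spectralProjection (chiralHamiltonian_isSelfAdjoint S)
    (chirality_mul_chiralHamiltonian S) (chirality_mul_self _), inner_sub_right,
    ← inner_chirality_left, chirality_siteVec, chirality_siteVec, map_smul, inner_smul_left,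
    inner_smul_right]
  have hs : ∀ s : Bool, ‖(chiralSign s : ℂ)‖ = 1 := fun s => by cases s <;> simp [chiralSign]
  refine (norm_sub_le _ _).trans ?_
  rw [norm_mul, norm_mul, RCLike.norm_conj, hs, hs, one_mul, one_mul]
  linarith

end Sites

/-! ### Commutators with a switch function, and their traces. -/

section SwitchSum
open Filter Topology InnerProductSpace

/-- The matrix-unit expansion converges in operator norm, and its limit has the same entries as C.
-/
theorem hasSum_rankOne_of_summable_entries {ℋ : Type*} [NormedAddCommGroup ℋ]
    [InnerProductSpace ℂ ℋ] [CompleteSpace ℋ] {ι : Type*} (b : HilbertBasis ι ℂ ℋ)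
    {C : ℋ →L[ℂ] ℋ} (hs : Summable fun r : ι × ι => ‖⟪b r.1, C (b r.2)⟫_ℂ‖) :
    HasSum (fun r : ι × ι => rankOne ℂ (⟪b r.1, C (b r.2)⟫_ℂ • b r.1) (b r.2)) C := by
  classical
  have hb := b.orthonormal.1
  have hb' := orthonormal_iff_ite.1 b.orthonormal
  have hs' : Summable fun r : ι × ι => rankOne ℂ (⟪b r.1, C (b r.2)⟫_ℂ • b r.1) (b r.2) :=
    Summable.of_norm (hs.congr fun r => by simp [norm_smul, hb])
  obtain ⟨C', hC'⟩ := hs'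
  suffices h : C' = C by rw [h] at hC'; exact hC'
  have hent : ∀ p q, ⟪b p, C' (b q)⟫_ℂ = ⟪b p, C (b q)⟫_ℂ := fun p q => by
    rw [← (hasSum_inner_rankOne hC' (b p) (b q)).tsum_eq, tsum_eq_single (p, q)]
    · simp [inner_smul_right, hb]
    · rintro ⟨p', q'⟩ hne
      rw [inner_smul_right, hb', hb']
      by_cases h1 : p = p'
      · have : q' ≠ q := fun h => hne (by rw [h, h1])
        simp [this]
      · simp [h1]
  have hcol : ∀ q, C' (b q) = C (b q) := fun q =>
    b.repr.injective (lp.ext (funext fun p => by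
      rw [b.repr_apply_apply, b.repr_apply_apply, hent]))
  refine ContinuousLinearMap.ext_on (s := Set.range b) ?_ ?_
  · have := b.dense_span
    rwa [Submodule.dense_iff_topologicalClosure_eq_top]
  · rintro _ ⟨q, rfl⟩
    exact hcol q

theorem exists_eq_of_isSwitch {Λ : ℤ → ℝ} (hΛ : IsSwitch Λ) :
    ∃ R : ℤ, 0 ≤ R ∧ (∀ n, R ≤ n → Λ n = 1) ∧ ∀ n, n ≤ -R → Λ n = 0 := by
  obtain ⟨a, ha⟩ := Filter.eventually_atTop.1 hΛ.eventually_one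
  obtain ⟨b, hb⟩ := Filter.eventually_atBot.1 hΛ.eventually_zero
  refine ⟨max 0 (max a (-b)), le_max_left _ _, fun n hn => ha n ?_, fun n hn => hb n ?_⟩
  · exact ((le_max_left a (-b)).trans (le_max_right _ _)).trans hn
  · have := (le_max_right a (-b)).trans (le_max_right 0 _)
    omega

theorem exists_abs_le_of_isSwitch {Λ : ℤ → ℝ} (hΛ : IsSwitch Λ) :
    ∃ L : ℝ, ∀ n, |Λ n| ≤ L := by
  obtain ⟨L, hL⟩ := hΛ.bounded 1
  refine ⟨L, fun n => ?_⟩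
  have h := hL n
  rw [norm_smul, Complex.norm_real, Real.norm_eq_abs] at h
  have h1 : ‖(1 : Internal 1 →L[ℂ] Internal 1)‖ = 1 := ContinuousLinearMap.norm_id
  rwa [h1, mul_one] at h

/-- The commutator with a switch function is localized near the origin. -/
theorem exists_abs_sub_mul_exp_le {Λ : ℤ → ℝ} (hΛ : IsSwitch Λ) {μ : ℝ} (hμ : 0 < μ) :
    ∃ K : ℝ, 0 ≤ K ∧ ∀ n m : ℤ, |Λ n - Λ m| * Real.exp (-(μ * |(n : ℝ) - m|)) ≤
      K * (Real.exp (-(μ / 2 * |(n : ℝ)|)) * Real.exp (-(μ / 2 * |(m : ℝ)|))) := by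
  obtain ⟨R, hR0, hR1, hR2⟩ := exists_eq_of_isSwitch hΛ
  obtain ⟨L, hL⟩ := exists_abs_le_of_isSwitch hΛ
  have hL0 : 0 ≤ L := (abs_nonneg _).trans (hL 0)
  refine ⟨2 * L * Real.exp (μ * R), by positivity, fun n m => ?_⟩
  by_cases h : Λ n = Λ m
  · rw [h, sub_self, abs_zero, zero_mul]; positivity
  -- If Λ differs at n and m, the two sites do not lie beyond R on the same side, whence |n| + |m| ≤
  -- 2R + 2|n − m|. Decay in the distance becomes half that rate in each of n and m, at the cost of
  -- e^(μR).
  have h1 : ¬ (R ≤ n ∧ R ≤ m) := fun h' => h (by rw [hR1 n h'.1, hR1 m h'.2])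
  have h2 : ¬ (n ≤ -R ∧ m ≤ -R) := fun h' => h (by rw [hR2 n h'.1, hR2 m h'.2])
  have h3 : |n| + |m| ≤ 2 * R + 2 * |n - m| := by
    rcases abs_cases n with ⟨e1, _⟩ | ⟨e1, _⟩ <;> rcases abs_cases m with ⟨e2, _⟩ | ⟨e2, _⟩ <;>
    rcases abs_cases (n - m) with ⟨e3, _⟩ | ⟨e3, _⟩ <;> omega
  have h4 : |(n : ℝ)| + |(m : ℝ)| ≤ 2 * R + 2 * |(n : ℝ) - m| := by exact_mod_cast h3
  have h5 : |Λ n - Λ m| ≤ 2 * L := (abs_sub _ _).trans (by linarith [hL n, hL m])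
  rw [mul_assoc (2 * L), ← Real.exp_add, ← Real.exp_add]
  gcongr
  nlinarith

/-- The real power is dominated by a natural one; shifting n by 1 produces the base 1 + n, and the
factor e^r compensates in the exponential. -/
theorem summable_rpow_mul_exp_int (ν : ℝ) {r : ℝ} (hr : 0 < r) :
    Summable fun n : ℤ => (1 + |(n : ℝ)|) ^ ν * Real.exp (-(r * |(n : ℝ)|)) := by
  have key : Summable fun n : ℕ => (1 + (n : ℝ)) ^ ν * Real.exp (-(r * n)) := by
    obtain ⟨k, hk⟩ := exists_nat_ge ν
    have h1 := (summable_nat_add_iff 1).2 (Real.summable_pow_mul_exp_neg_nat_mul k hr)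
    refine Summable.of_nonneg_of_le (fun n => by positivity) (fun n => ?_)
      (h1.mul_left (Real.exp r))
    have h2 : Real.exp r * (((n + 1 : ℕ) : ℝ) ^ k * Real.exp (-r * (n + 1 : ℕ))) =
        (1 + (n : ℝ)) ^ k * Real.exp (-(r * n)) := by
      rw [mul_left_comm, ← Real.exp_add]
      push_cast
      ring_nf
    rw [h2, ← Real.rpow_natCast]
    gcongr
    simp
  refine Summable.of_nat_of_neg ?_ ?_ <;> simpa using key

theorem summable_site_rpow_mul_exp (N : ℕ) (ν : ℝ) {r : ℝ} (hr : 0 < r) :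
    Summable fun p : ℤ × Bool × Fin N =>
      (1 + |(p.1 : ℝ)|) ^ ν * Real.exp (-(r * |(p.1 : ℝ)|)) := by
  have h := (summable_rpow_mul_exp_int ν hr).mul_of_nonneg
    (Summable.of_finite (f := fun _ : Bool × Fin N => (1 : ℝ)))
    (fun n => by positivity) (fun _ => zero_le_one)
  simpa using h

/-- A summable majorant for the commutator of a switch function with operators whose kernels decay
exponentially. -/
theorem exists_summable_bound (N : ℕ) {Λ : ℤ → ℝ} (hΛ : IsSwitch Λ) {μ ν : ℝ} (hμ : 0 < μ)
    (hν : 0 < ν) (C : ℝ) :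
    ∃ B : (ℤ × Bool × Fin N) × (ℤ × Bool × Fin N) → ℝ, Summable B ∧
      ∀ (p q : ℤ × Bool × Fin N) (z : ℂ), ‖z‖ ≤ 2 * (max C 0 * ((1 + |(p.1 : ℝ)|) ^ ν *
        Real.exp (-(μ * |(p.1 : ℝ) - q.1|)))) → |Λ p.1 - Λ q.1| * ‖z‖ ≤ B (p, q) := by
  obtain ⟨K, hK0, hK⟩ := exists_abs_sub_mul_exp_le hΛ hμ
  set g : ℤ × Bool × Fin N → ℝ := fun p =>
    (1 + |(p.1 : ℝ)|) ^ ν * Real.exp (-(μ / 2 * |(p.1 : ℝ)|)) with hg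
  have hgs : Summable g := summable_site_rpow_mul_exp N ν (half_pos hμ)
  refine ⟨fun r => 2 * max C 0 * K * (g r.1 * g r.2),
    (hgs.mul_of_nonneg hgs (fun p => by positivity) (fun p => by positivity)).mul_left _, ?_⟩
  intro p q z hz
  have h0 : 0 ≤ max C 0 := le_max_right _ _
  -- The growth factor in q is inserted only to make the majorant a product g(p)g(q).
  have h1 : 1 ≤ (1 + |(q.1 : ℝ)|) ^ ν :=
    Real.one_le_rpow (by linarith [abs_nonneg (q.1 : ℝ)]) hν.le
  calc |Λ p.1 - Λ q.1| * ‖z‖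
      ≤ |Λ p.1 - Λ q.1| * (2 * (max C 0 * ((1 + |(p.1 : ℝ)|) ^ ν *
        Real.exp (-(μ * |(p.1 : ℝ) - q.1|))))) := by gcongr
    _ = 2 * max C 0 * (1 + |(p.1 : ℝ)|) ^ ν *
        (|Λ p.1 - Λ q.1| * Real.exp (-(μ * |(p.1 : ℝ) - q.1|))) := by ring
    _ ≤ 2 * max C 0 * (1 + |(p.1 : ℝ)|) ^ ν * (K * (Real.exp (-(μ / 2 * |(p.1 : ℝ)|)) *
        (1 * Real.exp (-(μ / 2 * |(q.1 : ℝ)|))))) := by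
          rw [one_mul]; exact mul_le_mul_of_nonneg_left (hK _ _) (by positivity)
    _ ≤ 2 * max C 0 * (1 + |(p.1 : ℝ)|) ^ ν * (K * (Real.exp (-(μ / 2 * |(p.1 : ℝ)|)) *
        ((1 + |(q.1 : ℝ)|) ^ ν * Real.exp (-(μ / 2 * |(q.1 : ℝ)|))))) := by gcongr
    _ = 2 * max C 0 * K * (g p * g q) := by simp only [hg]; ring

variable {N : ℕ}

/-- The trace of `Π D [Λ, D]` in terms of the matrix elements of `D`. -/
noncomputable def switchSum (Λ : ℤ → ℝ) (D : Dimer (Ell ℤ N) →L[ℂ] Dimer (Ell ℤ N)) : ℝ :=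
  ∑' r : (ℤ × Bool × Fin N) × (ℤ × Bool × Fin N), chiralSign r.2.2.1 *
    (Λ r.1.1 - Λ r.2.1) * ‖⟪siteVec r.1, D (siteVec r.2)⟫_ℂ‖ ^ 2

theorem abs_chiralSign (s : Bool) : |chiralSign s| = 1 := by cases s <;> simp [chiralSign]

theorem norm_siteVec {X : Type} (p : X × Bool × Fin N) : ‖siteVec p‖ = 1 :=
  orthonormal_siteVec.1 p

/-- The commutator has entries (Λ_p − Λ_q)⟨p, Dq⟩. Their summability gives a rank-one expansion,
which survives left multiplication by ΠD. The trace then pairs ⟨p, Dq⟩ with ⟨q, Dp⟩, its conjugate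
by symmetry. -/
theorem isTraceClass_and_trace_eq_switchSum {Λ : ℤ → ℝ} (hΛ : IsSwitch Λ)
    {D : Dimer (Ell ℤ N) →L[ℂ] Dimer (Ell ℤ N)} (hD : ∀ φ ψ, ⟪D φ, ψ⟫_ℂ = ⟪φ, D ψ⟫_ℂ)
    (hs : Summable fun r : (ℤ × Bool × Fin N) × (ℤ × Bool × Fin N) =>
      |Λ r.1.1 - Λ r.2.1| * ‖⟪siteVec r.1, D (siteVec r.2)⟫_ℂ‖) :
    IsTraceClass (chirality (Ell ℤ N) * D * (switchOp N hΛ * D - D * switchOp N hΛ)) ∧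
      trace (chirality (Ell ℤ N) * D * (switchOp N hΛ * D - D * switchOp N hΛ)) =
        (switchSum Λ D : ℂ) := by
  set C := switchOp N hΛ * D - D * switchOp N hΛ with hC
  set Y := chirality (Ell ℤ N) * D with hY
  have hΛs : ∀ (p : ℤ × Bool × Fin N) φ, ⟪siteVec p, switchOp N hΛ φ⟫_ℂ =
      Λ p.1 * ⟪siteVec p, φ⟫_ℂ := fun p φ => by
    rw [inner_siteVec, inner_siteVec]
    obtain ⟨x, s, i⟩ := p
    cases s <;> simp [siteCoord, switchOp, blockOp_apply, hop_apply]
  have hent : ∀ p q : ℤ × Bool × Fin N, ⟪siteVec p, C (siteVec q)⟫_ℂ =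
      ((Λ p.1 - Λ q.1 : ℝ) : ℂ) * ⟪siteVec p, D (siteVec q)⟫_ℂ := fun p q => by
    rw [hC, sub_apply, mul_apply_eq_comp, mul_apply_eq_comp, inner_sub_right, hΛs,
      switchOp_siteVec, map_smul, inner_smul_right]
    push_cast
    ring
  have hs' : Summable fun r : (ℤ × Bool × Fin N) × (ℤ × Bool × Fin N) =>
      ‖⟪siteBasis ℤ N r.1, C (siteBasis ℤ N r.2)⟫_ℂ‖ := by
    refine hs.congr fun r => ?_
    rw [siteBasis_apply, siteBasis_apply, hent, norm_mul, Complex.norm_real, Real.norm_eq_abs]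
  have h1 := hasSum_rankOne_of_summable_entries (siteBasis ℤ N) hs'
  simp only [siteBasis_apply] at h1 hs'
  have h2 : HasSum (fun r : (ℤ × Bool × Fin N) × (ℤ × Bool × Fin N) =>
      rankOne ℂ (Y (⟪siteVec r.1, C (siteVec r.2)⟫_ℂ • siteVec r.1)) (siteVec r.2)) (Y * C) := by
    refine ((ContinuousLinearMap.compL ℂ _ _ _ Y).hasSum h1).congr_fun fun r => ?_
    ext x
    simp
  have h3 : Summable fun r : (ℤ × Bool × Fin N) × (ℤ × Bool × Fin N) =>
      ‖Y (⟪siteVec r.1, C (siteVec r.2)⟫_ℂ • siteVec r.1)‖ * ‖(siteVec r.2 : Dimer (Ell ℤ N))‖ := by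
    refine Summable.of_nonneg_of_le (fun r => by positivity) (fun r => ?_) (hs'.mul_left ‖Y‖)
    rw [norm_siteVec, mul_one]
    refine (Y.le_opNorm _).trans ?_
    rw [norm_smul, norm_siteVec, mul_one]
  refine ⟨isTraceClass_of_hasSum_rankOne h2 h3, ?_⟩
  rw [trace_eq_of_hasSum_rankOne h2 h3, switchSum, Complex.ofReal_tsum]
  refine tsum_congr fun r => ?_
  have hz : ⟪siteVec r.2, D (siteVec r.1)⟫_ℂ =
      (starRingEnd ℂ) ⟪siteVec r.1, D (siteVec r.2)⟫_ℂ := by rw [inner_conj_symm, hD]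
  rw [map_smul, inner_smul_right, hent, hY, mul_apply_eq_comp, ← inner_chirality_left,
    chirality_siteVec, inner_smul_left, hz, Complex.conj_ofReal]
  generalize ⟪siteVec r.1, D (siteVec r.2)⟫_ℂ = z
  push_cast
  rw [← Complex.mul_conj']
  ring

/-- Dominated convergence for `switchSum`. -/
theorem tendsto_switchSum {α : Type*} {l : Filter α} {Λ : ℤ → ℝ}
    {D : α → Dimer (Ell ℤ N) →L[ℂ] Dimer (Ell ℤ N)} {D' : Dimer (Ell ℤ N) →L[ℂ] Dimer (Ell ℤ N)}
    {B : (ℤ × Bool × Fin N) × (ℤ × Bool × Fin N) → ℝ} (hB : Summable B)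
    (hn : ∀ a, ‖D a‖ ≤ 1)
    (hD : ∀ a p q, |Λ p.1 - Λ q.1| * ‖⟪siteVec p, D a (siteVec q)⟫_ℂ‖ ≤ B (p, q))
    (h : ∀ ψ, Tendsto (fun a => D a ψ) l (𝓝 (D' ψ))) :
    Tendsto (fun a => switchSum Λ (D a)) l (𝓝 (switchSum Λ D')) := by
  refine tendsto_tsum_of_dominated_convergence hB (fun r => ?_) (.of_forall fun a r => ?_)
  · exact ((tendsto_const_nhds.inner (h _)).norm.pow 2).const_mul _
  · have h1 : ‖⟪siteVec r.1, D a (siteVec r.2)⟫_ℂ‖ ≤ 1 := by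
      refine (norm_inner_le_norm _ _).trans ?_
      rw [norm_siteVec, one_mul]
      simpa [norm_siteVec] using (D a).le_of_opNorm_le (hn a) (siteVec r.2)
    rw [norm_mul, norm_mul, Real.norm_eq_abs, abs_chiralSign, one_mul, norm_pow, norm_norm]
    refine le_trans ?_ (hD a r.1 r.2)
    rw [Real.norm_eq_abs]
    gcongr
    -- Entries of a contraction have modulus at most 1, so the majorant for the first power also
    -- bounds the square.
    exact pow_le_of_le_one (norm_nonneg _) h1 two_ne_zero

/-- The value of `switchSum` for an operator that is supported on a half-line. -/
theorem switchSum_eq_of_halfLine {Λ : ℤ → ℝ} {D : Dimer (Ell ℤ N) →L[ℂ] Dimer (Ell ℤ N)}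
    (hD : ∀ φ ψ, ⟪D φ, ψ⟫_ℂ = ⟪φ, D ψ⟫_ℂ)
    (hΓ : ∀ ψ, chirality (Ell ℤ N) (D ψ) = -(D (chirality (Ell ℤ N) ψ)))
    {a b : ℤ} (hb : ∀ n, n ≤ b → Λ n = 0) (ha : ∀ p, a < p.1 → D (siteVec p) = 0) :
    switchSum Λ D = -2 * ∑' p : ℤ × Bool × Fin N,
      chiralSign p.2.1 * Λ p.1 * ‖D (siteVec p)‖ ^ 2 := by
  set w : ℤ × Bool × Fin N → ℤ × Bool × Fin N → ℝ :=
    fun p q => ‖⟪siteVec p, D (siteVec q)⟫_ℂ‖ ^ 2 with hw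
  have hsymm : ∀ p q, w p q = w q p := fun p q => by
    simp only [hw]
    rw [← hD, norm_inner_symm]
  have hrow : ∀ p, HasSum (fun q => w p q) (‖D (siteVec p)‖ ^ 2) := fun p => by
    have h := hasSum_norm_inner_sq (siteBasis ℤ N) (D (siteVec p))
    simp only [siteBasis_apply] at h
    exact h.congr_fun fun q => hsymm p q
  -- Anticommutation with Π kills the entries between sites of equal chirality.
  have hsign : ∀ p q, chiralSign q.2.1 * w p q = -(chiralSign p.2.1 * w p q) := by
    intro p q
    have h1 : ⟪siteVec p, chirality _ (D (siteVec q))⟫_ℂ =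
      -⟪siteVec p, D (chirality _ (siteVec q))⟫_ℂ := by rw [hΓ, inner_neg_right]
    rw [← inner_chirality_left, chirality_siteVec, chirality_siteVec, map_smul, inner_smul_left,
      inner_smul_right, Complex.conj_ofReal] at h1
    simp only [hw]
    generalize ⟪siteVec p, D (siteVec q)⟫_ℂ = z at h1 ⊢
    have h2 : ∀ s t : Bool, (chiralSign s : ℂ) * z = -((chiralSign t : ℂ) * z) →
        chiralSign t * ‖z‖ ^ 2 = -(chiralSign s * ‖z‖ ^ 2) := by
      intro s t h
      cases s <;> cases t <;> simp [chiralSign, self_eq_neg, neg_eq_self] at h ⊢ <;> exact h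
    exact h2 _ _ h1
  set f : (ℤ × Bool × Fin N) × (ℤ × Bool × Fin N) → ℝ :=
    fun r => chiralSign r.2.2.1 * Λ r.1.1 * w r.1 r.2 with hf
  -- This is what permits separating Λ_p from Λ_q: only positions p between b and a contribute, and
  -- each row is summable by Parseval.
  have hfs : Summable f := by
    refine Summable.of_norm ?_
    have hn : ∀ r, ‖f r‖ = |Λ r.1.1| * w r.1 r.2 := fun r => by
      simp only [hf, norm_mul, Real.norm_eq_abs, abs_chiralSign, one_mul]
      rw [abs_of_nonneg (by positivity : 0 ≤ w r.1 r.2)]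
    refine (summable_prod_of_nonneg fun r => norm_nonneg _).2 ⟨fun p => ?_, ?_⟩
    · simp only [hn]
      exact (hrow p).summable.mul_left _
    · simp only [hn, tsum_mul_left, (hrow _).tsum_eq]
      refine summable_of_ne_finset_zero (s := Finset.Icc b a ×ˢ Finset.univ) fun p hp => ?_
      have : ¬ (b ≤ p.1 ∧ p.1 ≤ a) := by simpa using hp
      by_cases h1 : p.1 ≤ b
      · simp [hb _ h1]
      · simp [ha p (by omega)]
  have hswap : Summable fun r => f (Prod.swap r) := (Equiv.prodComm _ _).summable_iff.2 hfs
  -- Exchanging p and q flips the chirality sign, so the Λ_q part equals the Λ_p part with its roles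
  -- swapped; this is the factor 2.
  have hterm : ∀ r, chiralSign r.2.2.1 * (Λ r.1.1 - Λ r.2.1) *
      ‖⟪siteVec r.1, D (siteVec r.2)⟫_ℂ‖ ^ 2 = f r + f (Prod.swap r) := by
    rintro ⟨p, q⟩
    change chiralSign q.2.1 * (Λ p.1 - Λ q.1) * w p q =
      chiralSign q.2.1 * Λ p.1 * w p q + chiralSign p.2.1 * Λ q.1 * w q p
    rw [hsymm q p]
    linear_combination (-Λ q.1) * hsign p q
  have h1 : switchSum Λ D = ∑' r, f r + ∑' r, f (Prod.swap r) := by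
    rw [switchSum, ← hfs.tsum_add hswap]
    exact tsum_congr hterm
  have h2 : ∑' r, f (Prod.swap r) = ∑' r, f r := (Equiv.prodComm _ _).tsum_eq f
  have h3 : ∑' r, f r = -∑' p : ℤ × Bool × Fin N,
      chiralSign p.2.1 * Λ p.1 * ‖D (siteVec p)‖ ^ 2 := by
    rw [hfs.tsum_prod, ← tsum_neg]
    refine tsum_congr fun p => ?_
    rw [← (hrow p).tsum_eq, ← tsum_mul_left, ← tsum_neg]
    refine tsum_congr fun q => ?_
    simp only [hf]
    linear_combination Λ p.1 * hsign p q
  rw [h1, h2, h3]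
  ring

end SwitchSum

/-! ### Half-line operators and the zero modes at the edge. -/

section Edge
open Filter Topology InnerProductSpace
variable {N : ℕ}

/-- The inclusion of the half-line dimer space into the dimer space of the line. -/
noncomputable def edgeInclusion (N : ℕ) (a : ℤ) :
    Dimer (Ell (Set.Iic a) N) →L[ℂ] Dimer (Ell ℤ N) :=
  blockOp (halfLineInclusion N a) 0 0 (halfLineInclusion N a)

/-- The restriction to the half-line. -/
noncomputable def edgeRestriction (N : ℕ) (a : ℤ) :
    Dimer (Ell ℤ N) →L[ℂ] Dimer (Ell (Set.Iic a) N) :=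
  blockOp (ContinuousLinearMap.adjoint (halfLineInclusion N a)) 0 0
    (ContinuousLinearMap.adjoint (halfLineInclusion N a))

theorem inner_edgeInclusion_left (a : ℤ) (φ : Dimer (Ell (Set.Iic a) N)) (ψ : Dimer (Ell ℤ N)) :
    ⟪edgeInclusion N a φ, ψ⟫_ℂ = ⟪φ, edgeRestriction N a ψ⟫_ℂ := by
  simp [edgeInclusion, edgeRestriction, blockOp_apply, WithLp.prod_inner_apply,
    ContinuousLinearMap.adjoint_inner_right]

theorem inner_edgeRestriction_left (a : ℤ) (φ : Dimer (Ell ℤ N))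
    (ψ : Dimer (Ell (Set.Iic a) N)) :
    ⟪edgeRestriction N a φ, ψ⟫_ℂ = ⟪φ, edgeInclusion N a ψ⟫_ℂ := by
  rw [← inner_conj_symm, ← inner_edgeInclusion_left, inner_conj_symm]

theorem siteCoord_edgeRestriction (a : ℤ) (p : Set.Iic a × Bool × Fin N) (ψ : Dimer (Ell ℤ N)) :
    siteCoord p (edgeRestriction N a ψ) = siteCoord ((p.1 : ℤ), p.2) ψ := by
  obtain ⟨x, s, i⟩ := p
  cases s <;>
    simp [siteCoord, edgeRestriction, blockOp_apply, adjoint_halfLineInclusion_apply]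

theorem siteCoord_edgeInclusion (a : ℤ) (p : ℤ × Bool × Fin N)
    (ψ : Dimer (Ell (Set.Iic a) N)) : siteCoord p (edgeInclusion N a ψ) =
      if h : p.1 ≤ a then siteCoord ((⟨p.1, h⟩ : Set.Iic a), p.2) ψ else 0 := by
  obtain ⟨x, s, i⟩ := p
  by_cases h : x ≤ a <;> cases s <;>
    simp [siteCoord, edgeInclusion, blockOp_apply, halfLineInclusion_apply, h]

theorem edgeRestriction_edgeInclusion (a : ℤ) (ψ : Dimer (Ell (Set.Iic a) N)) :
    edgeRestriction N a (edgeInclusion N a ψ) = ψ := by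
  refine siteCoord_ext fun p => ?_
  rw [siteCoord_edgeRestriction, siteCoord_edgeInclusion]
  exact dif_pos p.1.2

theorem norm_edgeInclusion_apply (a : ℤ) (ψ : Dimer (Ell (Set.Iic a) N)) :
    ‖edgeInclusion N a ψ‖ = ‖ψ‖ := by
  have h : ⟪edgeInclusion N a ψ, edgeInclusion N a ψ⟫_ℂ = ⟪ψ, ψ⟫_ℂ := by
    rw [inner_edgeInclusion_left, edgeRestriction_edgeInclusion]
  rw [inner_self_eq_norm_sq_to_K, inner_self_eq_norm_sq_to_K] at h
  exact (sq_eq_sq₀ (norm_nonneg _) (norm_nonneg _)).1 (by exact_mod_cast h)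

theorem norm_edgeInclusion_le (a : ℤ) : ‖edgeInclusion N a‖ ≤ 1 :=
  ContinuousLinearMap.opNorm_le_bound _ zero_le_one fun ψ => by
    rw [norm_edgeInclusion_apply, one_mul]

theorem norm_edgeRestriction_le (a : ℤ) : ‖edgeRestriction N a‖ ≤ 1 :=
  ContinuousLinearMap.opNorm_le_bound _ zero_le_one fun ψ => by
    have h : ‖edgeRestriction N a ψ‖ ^ 2 ≤ ‖ψ‖ * ‖edgeRestriction N a ψ‖ := by
      rw [← inner_self_eq_norm_sq (𝕜 := ℂ)]
      refine (RCLike.re_le_norm _).trans ?_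
      rw [inner_edgeRestriction_left]
      refine (norm_inner_le_norm _ _).trans ?_
      rw [norm_edgeInclusion_apply]
    rw [one_mul]
    by_contra! h1
    nlinarith [norm_nonneg ψ]

theorem edgeInclusion_edgeRestriction_siteVec (a : ℤ) (p : ℤ × Bool × Fin N) :
    edgeInclusion N a (edgeRestriction N a (siteVec p)) = if p.1 ≤ a then siteVec p else 0 := by
  refine siteCoord_ext fun q => ?_
  rw [siteCoord_edgeInclusion]
  have h0 : siteCoord q (0 : Dimer (Ell ℤ N)) = 0 := by rw [← inner_siteVec, inner_zero_right]
  split_ifs with h1 h2 h2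
  · rw [siteCoord_edgeRestriction]
  · rw [siteCoord_edgeRestriction, h0, siteCoord_siteVec, if_neg]
    rintro rfl
    exact h2 h1
  · rw [siteCoord_siteVec, if_neg]
    rintro rfl
    exact h1 h2
  · exact h0.symm

theorem norm_edgeRestriction_siteVec_sq (a : ℤ) (p : ℤ × Bool × Fin N) :
    ‖edgeRestriction N a (siteVec p)‖ ^ 2 = if p.1 ≤ a then 1 else 0 := by
  rw [← norm_edgeInclusion_apply, edgeInclusion_edgeRestriction_siteVec]
  split_ifs <;> simp [norm_siteVec]

theorem edgeRestriction_siteVec {a : ℤ} {p : ℤ × Bool × Fin N} (h : p.1 ≤ a) :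
    edgeRestriction N a (siteVec p) = siteVec ((⟨p.1, h⟩ : Set.Iic a), p.2) := by
  refine siteCoord_ext fun q => ?_
  rw [siteCoord_edgeRestriction, siteCoord_siteVec, siteCoord_siteVec]
  obtain ⟨x, t⟩ := q
  obtain ⟨y, u⟩ := p
  simp [Prod.ext_iff, Subtype.ext_iff]

theorem edgeRestriction_siteVec_of_lt {a : ℤ} {p : ℤ × Bool × Fin N} (h : a < p.1) :
    edgeRestriction N a (siteVec p) = 0 := by
  have h1 := norm_edgeRestriction_siteVec_sq a p
  rw [if_neg (by omega)] at h1
  exact norm_eq_zero.1 (pow_eq_zero_iff two_ne_zero |>.1 h1)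

theorem tendsto_edgeInclusion_edgeRestriction (ψ : Dimer (Ell ℤ N)) :
    Tendsto (fun a => edgeInclusion N a (edgeRestriction N a ψ)) atTop (𝓝 ψ) := by
  have hb : ∀ a, ‖edgeInclusion N a ∘L edgeRestriction N a‖ ≤ 1 := fun a =>
    (ContinuousLinearMap.opNorm_comp_le _ _).trans
      (mul_le_one₀ (norm_edgeInclusion_le a) (norm_nonneg _) (norm_edgeRestriction_le a))
  refine tendsto_of_tendsto_on_total (Y := 1) hb ContinuousLinearMap.norm_id_le
    (siteBasis ℤ N).dense_span ?_ ψ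
  rintro _ ⟨p, rfl⟩
  rw [siteBasis_apply]
  refine tendsto_const_nhds.congr' ?_
  filter_upwards [eventually_ge_atTop p.1] with a ha
  rw [ContinuousLinearMap.comp_apply, edgeInclusion_edgeRestriction_siteVec, if_pos ha]
  rfl

theorem chirality_edgeInclusion (a : ℤ) (ψ : Dimer (Ell (Set.Iic a) N)) :
    chirality _ (edgeInclusion N a ψ) = edgeInclusion N a (chirality _ ψ) := by
  simp [chirality, edgeInclusion, blockOp_apply]

theorem chirality_edgeRestriction (a : ℤ) (ψ : Dimer (Ell ℤ N)) :
    chirality _ (edgeRestriction N a ψ) = edgeRestriction N a (chirality _ ψ) := by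
  simp [chirality, edgeRestriction, blockOp_apply]

namespace ChiralChain
variable (M : ChiralChain N)

/-- This brings the edge Hamiltonian into the form RTJ of the abstract convergence results. -/
theorem edgeH_eq (a : ℤ) : M.edgeH a = edgeRestriction N a ∘L M.H ∘L edgeInclusion N a := by
  refine ContinuousLinearMap.ext fun ψ => ?_
  simp [edgeH, H, chiralHamiltonian, edgeRestriction, edgeInclusion, blockOp_apply, edgeS,
    ContinuousLinearMap.adjoint_comp]

theorem matOp_injective (g : GL (Fin N) ℂ) {v : Internal N} (h : matOp g v = 0) : v = 0 := by
  have h1 : matOp g⁻¹ (matOp g v) = v := by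
    have : matOp g⁻¹ * matOp g = 1 := by
      rw [matOp, matOp, ← map_mul, ← Units.val_mul, inv_mul_cancel, Units.val_one, map_one]
    exact congrArg (fun Z : Internal N →L[ℂ] Internal N => Z v) this
  rw [← h1, h, map_zero]

theorem matOp_apply_inv (g : GL (Fin N) ℂ) (v : Internal N) : matOp g (matOp g⁻¹ v) = v := by
  have : matOp g * matOp g⁻¹ = 1 := by
    rw [matOp, matOp, ← map_mul, ← Units.val_mul, mul_inv_cancel, Units.val_one, map_one]
  exact congrArg (fun Z : Internal N →L[ℂ] Internal N => Z v) this

/-- Restrictions of solutions of `S ψ = 0` on the half-line are edge zero modes. -/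
theorem edgeH_edgeRestriction_eq_zero {a : ℤ} {ψ : Dimer (Ell ℤ N)} (h0 : ψ.snd = 0)
    (h : ∀ n ≤ a, M.S ψ.fst n = 0) : M.edgeH a (edgeRestriction N a ψ) = 0 := by
  have h1 : M.edgeS a (ContinuousLinearMap.adjoint (halfLineInclusion N a) ψ.fst) = 0 := by
    refine lp.ext (funext fun n => ?_)
    have hn : (n : ℤ) ≤ a := n.2
    -- At a site n ≤ a, S involves only n − 1 and n, neither of which is affected by the truncation.
    have h2 : ∀ m ≤ a, halfLineInclusion N a
        (ContinuousLinearMap.adjoint (halfLineInclusion N a) ψ.fst) m = ψ.fst m := fun m hm => by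
      rw [halfLineInclusion_apply, dif_pos hm, adjoint_halfLineInclusion_apply]
    have h3 := h n hn
    rw [S_apply] at h3
    rw [edgeS, ContinuousLinearMap.comp_apply, ContinuousLinearMap.comp_apply,
      adjoint_halfLineInclusion_apply, S_apply, h2 _ (by omega), h2 _ hn, h3]
    rfl
  simp [edgeH, chiralHamiltonian, edgeRestriction, blockOp_apply, h0, h1]

/-- The adjoint of the truncated operator is injective. -/
theorem eq_zero_of_adjoint_edgeS {a : ℤ} {χ : Ell (Set.Iic a) N}
    (h : ContinuousLinearMap.adjoint (M.edgeS a) χ = 0) : χ = 0 := by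
  set η := halfLineInclusion N a χ with hη
  -- The adjoint equation B_n*η_n + A_{n+1}*η_{n+1} = 0 in weak form, tested on vectors supported at
  -- n.
  have hrel : ∀ n ≤ a, ∀ v : Internal N,
      ⟪η n, matOp (M.B n) v⟫_ℂ + ⟪η (n + 1), matOp (M.A (n + 1)) v⟫_ℂ = 0 := by
    intro n hn v
    have h1 : ⟪η, M.S (lp.single 2 n v)⟫_ℂ = 0 := by
      rw [← halfLineInclusion_single a ⟨n, hn⟩ v, hη, ← ContinuousLinearMap.adjoint_inner_right]
      change ⟪χ, M.edgeS a (lp.single 2 _ v)⟫_ℂ = 0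
      rw [← ContinuousLinearMap.adjoint_inner_left, h, inner_zero_left]
    have h2 : M.S (lp.single 2 n v) = lp.single 2 n (matOp (M.B n) v) +
        lp.single 2 (n + 1) (matOp (M.A (n + 1)) v) := by
      refine lp.ext (funext fun m => ?_)
      rw [S_apply, lp.coeFn_add, Pi.add_apply, lp.single_apply, lp.single_apply, lp.single_apply]
      simp only [lp.coeFn_single]
      by_cases e1 : m = n
      · subst e1
        simp
      · by_cases e2 : m = n + 1
        · subst e2
          simp
        · have e3 : m - 1 ≠ n := fun h => e2 (by omega)
          simp [e1, e2, e3]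
    rw [h2, inner_add_right, lp.inner_single_right, lp.inner_single_right] at h1
    exact h1
  -- The recursion starts one site beyond the edge, where the extension by zero vanishes, and runs
  -- left. Testing with v = B_n⁻¹η_n isolates ‖η_n‖².
  have hz : ∀ k : ℕ, η (a + 1 - k) = 0 := by
    intro k
    induction k with
    | zero => rw [hη, halfLineInclusion_apply, dif_neg (by simp)]
    | succ k ih =>
      have h1 := hrel (a + 1 - (k + 1 : ℕ)) (by push_cast; omega)
        (matOp (M.B (a + 1 - (k + 1 : ℕ)))⁻¹ (η (a + 1 - (k + 1 : ℕ))))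
      rw [show a + 1 - ((k + 1 : ℕ) : ℤ) + 1 = a + 1 - k by push_cast; ring, ih, inner_zero_left,
        add_zero, matOp_apply_inv] at h1
      exact inner_self_eq_zero.1 h1
  refine lp.ext (funext fun n => ?_)
  have hn : (n : ℤ) ≤ a := n.2
  have h1 := hz (a + 1 - n).toNat
  rw [Int.toNat_of_nonneg (by omega), sub_sub_cancel, hη, halfLineInclusion_apply,
    dif_pos hn] at h1
  exact h1

/-- The second component lies in the kernel of S_a*, which is trivial. All edge zero modes therefore
have chirality +1, and no cancellation occurs in the edge index. -/
theorem snd_eq_zero_of_edgeH {a : ℤ} {φ : Dimer (Ell (Set.Iic a) N)} (h : M.edgeH a φ = 0) :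
    φ.snd = 0 := by
  refine M.eq_zero_of_adjoint_edgeS (a := a) ?_
  have := congrArg WithLp.fst h
  simpa [edgeH, chiralHamiltonian, blockOp_apply] using this

theorem S_eq_zero_of_edgeH {a : ℤ} {φ : Dimer (Ell (Set.Iic a) N)} (h : M.edgeH a φ = 0)
    {n : ℤ} (hn : n ≤ a) : M.S (edgeInclusion N a φ).fst n = 0 := by
  have h1 : M.edgeS a φ.fst = 0 := by
    have := congrArg WithLp.snd h
    simpa [edgeH, chiralHamiltonian, blockOp_apply] using this
  have h2 : (M.edgeS a φ.fst) ⟨n, hn⟩ = 0 := by rw [h1]; rfl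
  rw [edgeS, ContinuousLinearMap.comp_apply, ContinuousLinearMap.comp_apply,
    adjoint_halfLineInclusion_apply] at h2
  simpa [edgeInclusion, blockOp_apply] using h2

theorem snd_edgeInclusion_of_edgeH {a : ℤ} {φ : Dimer (Ell (Set.Iic a) N)}
    (h : M.edgeH a φ = 0) : (edgeInclusion N a φ).snd = 0 := by
  simp [edgeInclusion, blockOp_apply, M.snd_eq_zero_of_edgeH h]

/-- Truncations of edge zero modes are edge zero modes. -/
theorem edgeH_truncate {c a : ℤ} (hc : c ≤ a) {φ : Dimer (Ell (Set.Iic a) N)}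
    (h : M.edgeH a φ = 0) : M.edgeH c (edgeRestriction N c (edgeInclusion N a φ)) = 0 :=
  M.edgeH_edgeRestriction_eq_zero (M.snd_edgeInclusion_of_edgeH h)
    fun _ hn => M.S_eq_zero_of_edgeH h (hn.trans hc)

/-- The space of edge zero modes. -/
noncomputable def zeroModes (a : ℤ) : Submodule ℂ (Dimer (Ell (Set.Iic a) N)) :=
  LinearMap.ker (M.edgeH a : Dimer (Ell (Set.Iic a) N) →ₗ[ℂ] Dimer (Ell (Set.Iic a) N))

theorem mem_zeroModes {a : ℤ} {φ : Dimer (Ell (Set.Iic a) N)} :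
    φ ∈ M.zeroModes a ↔ M.edgeH a φ = 0 := Iff.rfl

theorem eq_zero_of_edgeInclusion {a : ℤ} {φ : Dimer (Ell (Set.Iic a) N)}
    (h : M.edgeH a φ = 0) (h0 : ∀ n ≤ a, (edgeInclusion N a φ).fst n = 0) : φ = 0 := by
  have h1 : ∀ n : Set.Iic a, φ.fst n = 0 := fun n => by
    have := h0 n n.2
    have hn : (n : ℤ) ≤ a := n.2
    simpa [edgeInclusion, blockOp_apply, halfLineInclusion_apply, hn] using this
  refine WithLp.ofLp_injective 2 (Prod.ext (lp.ext (funext h1)) (M.snd_eq_zero_of_edgeH h))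

/-- An edge zero mode is determined by its value at the edge. -/
theorem eq_zero_of_edge_value {a : ℤ} {φ : Dimer (Ell (Set.Iic a) N)} (h : M.edgeH a φ = 0)
    (h0 : (edgeInclusion N a φ).fst a = 0) : φ = 0 := by
  set ψ := (edgeInclusion N a φ).fst
  -- From A_nψ_{n−1} = −B_nψ_n and invertibility of A_n, a zero propagates to the left.
  have hz : ∀ k : ℕ, ψ (a - k) = 0 := by
    intro k
    induction k with
    | zero => simpa using h0
    | succ k ih =>
      have h1 := M.S_eq_zero_of_edgeH h (n := a - k) (by omega)
      rw [S_apply, ih, map_zero, add_zero] at h1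
      rw [show a - ((k + 1 : ℕ) : ℤ) = a - k - 1 by push_cast; ring]
      exact matOp_injective _ h1
  refine M.eq_zero_of_edgeInclusion h fun n hn => ?_
  have h1 := hz (a - n).toNat
  rwa [Int.toNat_of_nonneg (by omega), sub_sub_cancel] at h1

instance (a : ℤ) : FiniteDimensional ℂ (M.zeroModes a) := by
  let L : M.zeroModes a →ₗ[ℂ] Internal N :=
    { toFun := fun φ => (edgeInclusion N a φ.1).fst a
      map_add' := fun φ ψ => by simp
      map_smul' := fun c φ => by simp }
  refine FiniteDimensional.of_injective L ?_
  rw [← LinearMap.ker_eq_bot, LinearMap.ker_eq_bot']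
  intro φ hφ
  exact Subtype.ext (M.eq_zero_of_edge_value φ.2 hφ)

/-- Truncation to (-∞, a] is injective on zero modes: if ψ_a = 0, the equation at a + 1 reads
B_{a+1}ψ_{a+1} = 0. -/
theorem finrank_zeroModes_succ_le (a : ℤ) :
    Module.finrank ℂ (M.zeroModes (a + 1)) ≤ Module.finrank ℂ (M.zeroModes a) := by
  let L : M.zeroModes (a + 1) →ₗ[ℂ] M.zeroModes a :=
    { toFun := fun φ => ⟨edgeRestriction N a (edgeInclusion N (a + 1) φ.1),
        M.edgeH_truncate (by omega) φ.2⟩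
      map_add' := fun φ ψ => Subtype.ext (by simp)
      map_smul' := fun c φ => Subtype.ext (by simp) }
  refine LinearMap.finrank_le_finrank_of_injective (f := L) ?_
  rw [← LinearMap.ker_eq_bot, LinearMap.ker_eq_bot']
  intro φ hφ
  have h1 : edgeRestriction N a (edgeInclusion N (a + 1) φ.1) = 0 := congrArg Subtype.val hφ
  have h2 : (edgeInclusion N (a + 1) φ.1).fst a = 0 := by
    have h := congrArg (fun ψ => ψ.fst (⟨a, le_refl a⟩ : Set.Iic a)) h1
    simpa [edgeRestriction, blockOp_apply, adjoint_halfLineInclusion_apply] using h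
  have h3 := M.S_eq_zero_of_edgeH φ.2 (n := a + 1) le_rfl
  rw [S_apply, add_sub_cancel_right, h2, map_zero, zero_add] at h3
  exact Subtype.ext (M.eq_zero_of_edge_value φ.2 (matOp_injective _ h3))

/-- Since B_{a+1} is invertible, the equation at the new site can be solved: ψ_{a+1} =
−B_{a+1}⁻¹A_{a+1}ψ_a continues a zero mode. -/
theorem finrank_zeroModes_le_succ (a : ℤ) :
    Module.finrank ℂ (M.zeroModes a) ≤ Module.finrank ℂ (M.zeroModes (a + 1)) := by
  let V : Internal N →L[ℂ] Internal N := -(matOp (M.B (a + 1))⁻¹ ∘L matOp (M.A (a + 1)))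
  let E : Dimer (Ell (Set.Iic a) N) →L[ℂ] Dimer (Ell ℤ N) :=
    blockOp (halfLineInclusion N a + lp.singleContinuousLinearMap ℂ (fun _ : ℤ => Internal N) 2
      (a + 1) ∘L V ∘L lp.evalCLM ℂ (fun _ : ℤ => Internal N) 2 a ∘L halfLineInclusion N a) 0 0 0
  have hE : ∀ φ (n : ℤ), n ≤ a → (E φ).fst n = (edgeInclusion N a φ).fst n := fun φ n hn => by
    have hne : n ≠ a + 1 := by omega
    simp [E, edgeInclusion, blockOp_apply, hne]
  have hE1 : ∀ φ, (E φ).fst (a + 1) = V ((edgeInclusion N a φ).fst a) := fun φ => by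
    have he : ∀ η : Ell ℤ N, lp.evalCLM ℂ (fun _ : ℤ => Internal N) 2 a η = η a := fun _ => rfl
    simp [E, edgeInclusion, blockOp_apply, halfLineInclusion_apply, he]
  let L : M.zeroModes a →ₗ[ℂ] M.zeroModes (a + 1) :=
    { toFun := fun φ => ⟨edgeRestriction N (a + 1) (E φ.1),
        M.edgeH_edgeRestriction_eq_zero (by simp [E, blockOp_apply]) fun n hn => by
          rw [S_apply]
          rcases hn.lt_or_eq with h | rfl
          · rw [hE _ _ (by omega), hE _ _ (by omega), ← S_apply]
            exact M.S_eq_zero_of_edgeH φ.2 (by omega)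
          · rw [add_sub_cancel_right, hE _ _ le_rfl, hE1]
            simp [V, matOp_apply_inv]⟩
      map_add' := fun φ ψ => Subtype.ext (by simp)
      map_smul' := fun c φ => Subtype.ext (by simp) }
  refine LinearMap.finrank_le_finrank_of_injective (f := L) ?_
  rw [← LinearMap.ker_eq_bot, LinearMap.ker_eq_bot']
  intro φ hφ
  have h1 : edgeRestriction N (a + 1) (E φ.1) = 0 := congrArg Subtype.val hφ
  have h2 : (E φ.1).fst a = 0 := by
    have h := congrArg (fun ψ => ψ.fst (⟨a, by simp⟩ : Set.Iic (a + 1))) h1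
    simpa [edgeRestriction, blockOp_apply, adjoint_halfLineInclusion_apply] using h
  rw [hE _ _ le_rfl] at h2
  exact Subtype.ext (M.eq_zero_of_edge_value φ.2 h2)

/-- The number of edge zero modes does not depend on the position of the edge. -/
theorem finrank_zeroModes_eq (a b : ℤ) :
    Module.finrank ℂ (M.zeroModes a) = Module.finrank ℂ (M.zeroModes b) := by
  have hs : ∀ a, Module.finrank ℂ (M.zeroModes (a + 1)) = Module.finrank ℂ (M.zeroModes a) :=
    fun a => le_antisymm (M.finrank_zeroModes_succ_le a) (M.finrank_zeroModes_le_succ a)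
  have h0 : ∀ a, Module.finrank ℂ (M.zeroModes a) = Module.finrank ℂ (M.zeroModes 0) := by
    intro a
    induction a using Int.induction_on with
    | zero => rfl
    | succ n ih => rw [hs, ih]
    | pred n ih => rw [← ih, ← hs (-(n : ℤ) - 1), sub_add_cancel]
  rw [h0 a, h0 b]

end ChiralChain
end Edge

/-! ### The edge index, the escape of zero modes, and the duality. -/

section Duality
open Filter Topology InnerProductSpace

section ZeroProjection
variable {ℋ : Type*} [NormedAddCommGroup ℋ] [InnerProductSpace ℂ ℋ] [CompleteSpace ℋ]
  {T : ℋ →L[ℂ] ℋ}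

theorem inner_spectralProjection_zero_left (hT : IsSelfAdjoint T) (φ ψ : ℋ) :
    ⟪spectralProjection T {0} φ, ψ⟫_ℂ = ⟪φ, spectralProjection T {0} ψ⟫_ℂ := by
  rw [spectralProjection_zero_apply hT, spectralProjection_zero_apply hT, inner_sub_left,
    inner_sub_right, inner_borelCalculus_sign_left, inner_borelCalculus_sign_left]

theorem spectralProjection_zero_apply_of_apply_eq_zero (hT : IsSelfAdjoint T) {ψ : ℋ}
    (h : T ψ = 0) : spectralProjection T {0} ψ = ψ := by
  rw [spectralProjection_zero_apply hT, borelCalculus_sign_apply_of_apply_eq_zero hT h, map_zero,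
    sub_zero]

/-- It trades the zero projection for the sign, whose strong limit is under control. -/
theorem norm_spectralProjection_zero_sq (hT : IsSelfAdjoint T) (ψ : ℋ) :
    ‖spectralProjection T {0} ψ‖ ^ 2 = ‖ψ‖ ^ 2 - ‖borelCalculus T Real.sign ψ‖ ^ 2 := by
  have h : ⟪spectralProjection T {0} ψ, spectralProjection T {0} ψ⟫_ℂ =
      ⟪ψ, ψ⟫_ℂ - ⟪borelCalculus T Real.sign ψ, borelCalculus T Real.sign ψ⟫_ℂ := by
    rw [inner_spectralProjection_zero_left hT, spectralProjection_zero_apply_of_apply_eq_zero hT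
      (apply_spectralProjection_zero hT ψ), spectralProjection_zero_apply hT, inner_sub_right,
      inner_borelCalculus_sign_left]
  rw [inner_self_eq_norm_sq_to_K, inner_self_eq_norm_sq_to_K, inner_self_eq_norm_sq_to_K] at h
  exact_mod_cast h

theorem spectralProjection_zero_eq_sum (hT : IsSelfAdjoint T) {ι : Type*} [Fintype ι]
    {V : Submodule ℂ ℋ} (hV : ∀ ψ, ψ ∈ V ↔ T ψ = 0) (e : OrthonormalBasis ι ℂ V) (ψ : ℋ) :
    spectralProjection T {0} ψ = ∑ i, ⟪(e i : ℋ), ψ⟫_ℂ • (e i : ℋ) := by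
  have h := e.sum_repr ⟨spectralProjection T {0} ψ,
    (hV _).2 (apply_spectralProjection_zero hT ψ)⟩
  have h1 := congrArg Subtype.val h
  refine h1.symm.trans ?_
  push_cast
  refine Finset.sum_congr rfl fun i _ => ?_
  congr 1
  rw [e.repr_apply_apply, Submodule.coe_inner, ← inner_spectralProjection_zero_left hT,
    spectralProjection_zero_apply_of_apply_eq_zero hT ((hV _).1 (e i).2)]

theorem norm_spectralProjection_zero_sq_eq_sum (hT : IsSelfAdjoint T) {ι : Type*} [Fintype ι]
    {V : Submodule ℂ ℋ} (hV : ∀ ψ, ψ ∈ V ↔ T ψ = 0) (e : OrthonormalBasis ι ℂ V) (ψ : ℋ) :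
    ‖spectralProjection T {0} ψ‖ ^ 2 = ∑ i, ‖⟪(e i : ℋ), ψ⟫_ℂ‖ ^ 2 := by
  have h := e.sum_sq_norm_inner_right ⟨spectralProjection T {0} ψ,
    (hV _).2 (apply_spectralProjection_zero hT ψ)⟩
  rw [Submodule.coe_norm] at h
  rw [← h]
  refine Finset.sum_congr rfl fun i _ => ?_
  rw [Submodule.coe_inner, ← inner_spectralProjection_zero_left hT,
    spectralProjection_zero_apply_of_apply_eq_zero hT ((hV _).1 (e i).2)]

end ZeroProjection

variable {N : ℕ}

namespace ChiralChain
variable (M : ChiralChain N)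

theorem isSelfAdjoint_edgeH (a : ℤ) : IsSelfAdjoint (M.edgeH a) :=
  chiralHamiltonian_isSelfAdjoint _

/-- An orthonormal basis of the space of edge zero modes. -/
noncomputable def zeroBasis (a : ℤ) :
    OrthonormalBasis (Fin (Module.finrank ℂ (M.zeroModes a))) ℂ (M.zeroModes a) :=
  stdOrthonormalBasis ℂ (M.zeroModes a)

theorem norm_zeroBasis (a : ℤ) (i) : ‖(M.zeroBasis a i : Dimer (Ell (Set.Iic a) N))‖ = 1 :=
  (M.zeroBasis a).orthonormal.1 i

/-- Zero modes have chirality +1, so ΠP_{0,a} is the finite-rank projection P_{0,a} itself and its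
trace is its rank. -/
theorem isTraceClass_edgeOp_and_edgeIndex (a : ℤ) :
    IsTraceClass (M.edgeOp a) ∧ M.edgeIndex a = Module.finrank ℂ (M.zeroModes a) := by
  set e := M.zeroBasis a
  have hfix : ∀ i, chirality (Ell (Set.Iic a) N) (e i : Dimer (Ell (Set.Iic a) N)) = e i := by
    intro i
    have h := M.snd_eq_zero_of_edgeH (e i).2
    refine siteCoord_ext fun p => ?_
    obtain ⟨x, s, j⟩ := p
    cases s <;> simp [siteCoord, chirality, blockOp_apply, h]
  have hsum : HasSum (fun i => rankOne ℂ (e i : Dimer (Ell (Set.Iic a) N)) (e i : Dimer (Ell (Set.Iic a) N)))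
      (M.edgeOp a) := by
    convert hasSum_fintype (fun i => rankOne ℂ (e i : Dimer (Ell (Set.Iic a) N)) (e i : Dimer (Ell (Set.Iic a) N)))
      using 1
    refine ContinuousLinearMap.ext fun ψ => ?_
    rw [edgeOp, mul_apply_eq_comp,
      spectralProjection_zero_eq_sum (M.isSelfAdjoint_edgeH a) (fun _ => M.mem_zeroModes) e,
      map_sum, sum_apply]
    refine Finset.sum_congr rfl fun i _ => ?_
    rw [map_smul, hfix]
    rfl
  have hs : Summable fun i => ‖(e i : Dimer (Ell (Set.Iic a) N))‖ *
      ‖(e i : Dimer (Ell (Set.Iic a) N))‖ := Summable.of_finite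
  refine ⟨isTraceClass_of_hasSum_rankOne hsum hs, ?_⟩
  rw [edgeIndex, trace_eq_of_hasSum_rankOne hsum hs, tsum_fintype]
  simp [inner_self_eq_norm_sq_to_K, e, norm_zeroBasis]

/-- The flattened edge Hamiltonian, extended by zero to the line. -/
noncomputable def edgeSgn (a : ℤ) : Dimer (Ell ℤ N) →L[ℂ] Dimer (Ell ℤ N) :=
  edgeInclusion N a ∘L borelCalculus (M.edgeH a) Real.sign ∘L edgeRestriction N a

/-- The diagonal matrix elements of the projection onto the edge zero modes. -/
noncomputable def zeroDensity (a : ℤ) (p : ℤ × Bool × Fin N) : ℝ :=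
  ‖spectralProjection (M.edgeH a) {0} (edgeRestriction N a (siteVec p))‖ ^ 2

theorem zeroDensity_eq_sum (a : ℤ) (p : ℤ × Bool × Fin N) : M.zeroDensity a p =
    ∑ i, ‖⟪siteVec p, edgeInclusion N a (M.zeroBasis a i)⟫_ℂ‖ ^ 2 := by
  rw [zeroDensity, norm_spectralProjection_zero_sq_eq_sum (M.isSelfAdjoint_edgeH a)
    (fun _ => M.mem_zeroModes) (M.zeroBasis a)]
  refine Finset.sum_congr rfl fun i _ => ?_
  rw [← inner_edgeInclusion_left, norm_inner_symm]

theorem hasSum_zeroDensity (a : ℤ) :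
    HasSum (M.zeroDensity a) (Module.finrank ℂ (M.zeroModes a)) := by
  have h := hasSum_sum (s := Finset.univ) fun i _ =>
    hasSum_norm_inner_sq (siteBasis ℤ N) (edgeInclusion N a (M.zeroBasis a i))
  simp only [siteBasis_apply, ← zeroDensity_eq_sum, norm_edgeInclusion_apply,
    norm_zeroBasis] at h
  simpa using h

theorem chiralSign_mul_zeroDensity (a : ℤ) (p : ℤ × Bool × Fin N) :
    chiralSign p.2.1 * M.zeroDensity a p = M.zeroDensity a p := by
  obtain ⟨x, s, i⟩ := p
  cases s
  · have h0 : M.zeroDensity a (x, false, i) = 0 := by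
      rw [zeroDensity_eq_sum]
      refine Finset.sum_eq_zero fun j _ => ?_
      rw [inner_siteVec]
      simp [siteCoord, M.snd_edgeInclusion_of_edgeH (M.zeroBasis a j).2]
    rw [h0, mul_zero]
  · simp [chiralSign]

theorem norm_edgeSgn_apply (a : ℤ) (ψ : Dimer (Ell ℤ N)) : ‖M.edgeSgn a ψ‖ =
    ‖borelCalculus (M.edgeH a) Real.sign (edgeRestriction N a ψ)‖ :=
  norm_edgeInclusion_apply a _

/-- The diagonal of Σ_a² = 1 − P_{0,a} on the half-line. -/
theorem norm_edgeSgn_siteVec_sq (a : ℤ) (p : ℤ × Bool × Fin N) :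
    ‖M.edgeSgn a (siteVec p)‖ ^ 2 = (if p.1 ≤ a then 1 else 0) - M.zeroDensity a p := by
  rw [zeroDensity, norm_spectralProjection_zero_sq (M.isSelfAdjoint_edgeH a),
    norm_edgeRestriction_siteVec_sq, norm_edgeSgn_apply]
  ring

theorem norm_edgeSgn_le (a : ℤ) : ‖M.edgeSgn a‖ ≤ 1 :=
  (norm_comp_comp_le norm_edgeInclusion_le norm_edgeRestriction_le a _).trans
    (norm_borelCalculus_sign_le _)

theorem inner_edgeSgn_left (a : ℤ) (φ ψ : Dimer (Ell ℤ N)) :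
    ⟪M.edgeSgn a φ, ψ⟫_ℂ = ⟪φ, M.edgeSgn a ψ⟫_ℂ := by
  simp only [edgeSgn, ContinuousLinearMap.comp_apply]
  rw [inner_edgeInclusion_left, inner_borelCalculus_sign_left, inner_edgeRestriction_left]

theorem chirality_edgeSgn (a : ℤ) (ψ : Dimer (Ell ℤ N)) :
    chirality (Ell ℤ N) (M.edgeSgn a ψ) = -(M.edgeSgn a (chirality (Ell ℤ N) ψ)) := by
  simp only [edgeSgn, ContinuousLinearMap.comp_apply]
  rw [chirality_edgeInclusion, borelCalculus_sign_anticomm (M.isSelfAdjoint_edgeH a)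
    (chirality_mul_chiralHamiltonian _), chirality_edgeRestriction, map_neg]

theorem tendsto_edgeSgn (h0 : ∀ ψ, M.H ψ = 0 → ψ = 0) (ψ : Dimer (Ell ℤ N)) :
    Tendsto (fun a => M.edgeSgn a ψ) atTop (𝓝 (M.sgnH ψ)) := by
  have h := tendsto_compression_sign (l := (atTop : Filter ℤ)) (T := M.H)
    (chiralHamiltonian_isSelfAdjoint _) h0 norm_edgeInclusion_le norm_edgeRestriction_le
    tendsto_edgeInclusion_edgeRestriction
    (fun a => by rw [← edgeH_eq]; exact M.isSelfAdjoint_edgeH a) ψ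
  simp only [← edgeH_eq] at h
  exact h

/-- Flipping the chirality is a bijection that reverses every term, so the sum equals its negative;
no summability is required. -/
theorem tsum_chiralSign_eq_zero (g : ℤ → ℝ) :
    ∑' p : ℤ × Bool × Fin N, chiralSign p.2.1 * g p.1 = 0 := by
  let F : ℤ × Bool × Fin N ≃ ℤ × Bool × Fin N :=
    Equiv.prodCongr (Equiv.refl ℤ) (Equiv.prodCongr Equiv.boolNot (Equiv.refl (Fin N)))
  have h := F.tsum_eq fun p : ℤ × Bool × Fin N => chiralSign p.2.1 * g p.1
  have h1 : ∀ p : ℤ × Bool × Fin N, chiralSign (F p).2.1 * g (F p).1 =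
      -(chiralSign p.2.1 * g p.1) := by
    rintro ⟨x, s, i⟩
    cases s <;> simp [F, chiralSign]
  simp only [h1, tsum_neg] at h
  linarith

/-- The edge version of the bulk index counts the zero modes weighted with the switch function. -/
theorem switchSum_edgeSgn {Λ : ℤ → ℝ} (hΛ : IsSwitch Λ) (a : ℤ) :
    switchSum Λ (M.edgeSgn a) = 2 * ∑' p, Λ p.1 * M.zeroDensity a p := by
  obtain ⟨R, -, -, hR⟩ := exists_eq_of_isSwitch hΛ
  obtain ⟨L, hL⟩ := exists_abs_le_of_isSwitch hΛ
  rw [switchSum_eq_of_halfLine (M.inner_edgeSgn_left a) (M.chirality_edgeSgn a) hR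
    (a := a) fun p hp => by
      rw [edgeSgn, ContinuousLinearMap.comp_apply, ContinuousLinearMap.comp_apply,
        edgeRestriction_siteVec_of_lt hp, map_zero, map_zero]]
  have h1 : ∀ p : ℤ × Bool × Fin N, chiralSign p.2.1 * Λ p.1 * ‖M.edgeSgn a (siteVec p)‖ ^ 2 =
      chiralSign p.2.1 * (if p.1 ≤ a then Λ p.1 else 0) - Λ p.1 * M.zeroDensity a p := by
    intro p
    rw [norm_edgeSgn_siteVec_sq]
    have := M.chiralSign_mul_zeroDensity a p
    split_ifs
    · linear_combination (-Λ p.1) * this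
    · linear_combination (-Λ p.1) * this
  have hs1 : Summable fun p : ℤ × Bool × Fin N =>
      chiralSign p.2.1 * (if p.1 ≤ a then Λ p.1 else 0) := by
    refine summable_of_ne_finset_zero (s := Finset.Icc (-R) a ×ˢ Finset.univ) fun p hp => ?_
    have : ¬ (-R ≤ p.1 ∧ p.1 ≤ a) := by simpa using hp
    by_cases h : p.1 ≤ a
    · rw [hR p.1 (by omega)]; simp
    · simp [h]
  have hs2 : Summable fun p => Λ p.1 * M.zeroDensity a p := by
    refine Summable.of_norm_bounded ((M.hasSum_zeroDensity a).summable.mul_left L) fun p => ?_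
    rw [norm_mul, Real.norm_eq_abs, Real.norm_of_nonneg (by rw [zeroDensity]; positivity)]
    gcongr
    · rw [zeroDensity]; positivity
    · exact hL _
  simp only [h1]
  rw [hs1.tsum_sub hs2, tsum_chiralSign_eq_zero fun n => if n ≤ a then Λ n else 0]
  ring

/-- The edge zero modes near the origin are controlled by finitely many vectors. -/
theorem hasSum_zeroDensity_truncate {c a : ℤ} (hc : c ≤ a) :
    HasSum (fun p => if p.1 ≤ c then M.zeroDensity a p else 0)
      (∑ j, ‖spectralProjection (M.edgeH a) {0}
        (edgeRestriction N a (edgeInclusion N c (M.zeroBasis c j)))‖ ^ 2) := by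
  have h := hasSum_sum (s := Finset.univ) fun i _ => hasSum_norm_inner_sq (siteBasis ℤ N)
    (edgeInclusion N c (edgeRestriction N c (edgeInclusion N a (M.zeroBasis a i))))
  simp only [siteBasis_apply] at h
  -- Each truncation lies in ker H_c, so its norm is given by Parseval in a basis of that space.
  -- Both sides are the double sum of |⟨e_i, f_j⟩|², with e_i from ker H_a and f_j from ker H_c,
  -- summed in opposite orders.
  have h1 : ∑ i, ‖edgeInclusion N c (edgeRestriction N c
      (edgeInclusion N a (M.zeroBasis a i)))‖ ^ 2 = ∑ j, ‖spectralProjection (M.edgeH a) {0}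
        (edgeRestriction N a (edgeInclusion N c (M.zeroBasis c j)))‖ ^ 2 := by
    simp_rw [norm_spectralProjection_zero_sq_eq_sum (M.isSelfAdjoint_edgeH a)
      (fun _ => M.mem_zeroModes) (M.zeroBasis a)]
    rw [Finset.sum_comm]
    refine Finset.sum_congr rfl fun i _ => ?_
    rw [norm_edgeInclusion_apply, ← spectralProjection_zero_apply_of_apply_eq_zero
      (M.isSelfAdjoint_edgeH c) (M.edgeH_truncate hc (M.zeroBasis a i).2),
      norm_spectralProjection_zero_sq_eq_sum (M.isSelfAdjoint_edgeH c)
      (fun _ => M.mem_zeroModes) (M.zeroBasis c)]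
    refine Finset.sum_congr rfl fun j _ => ?_
    rw [← inner_edgeInclusion_left, ← inner_edgeInclusion_left, norm_inner_symm]
  rw [h1] at h
  refine h.congr_fun fun p => ?_
  have h2 : ∀ ψ : Dimer (Ell ℤ N), ⟪siteVec p, edgeInclusion N c (edgeRestriction N c ψ)⟫_ℂ =
      if p.1 ≤ c then ⟪siteVec p, ψ⟫_ℂ else 0 := fun ψ => by
    rw [← inner_edgeRestriction_left, ← inner_edgeInclusion_left,
      edgeInclusion_edgeRestriction_siteVec]
    split_ifs <;> simp
  simp only [h2]
  split_ifs with hp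
  · exact M.zeroDensity_eq_sum a p
  · simp

/-- Replacing Λ by 1 in tr(ΛP_{0,a}) costs at most a constant times the weight of the zero modes on
sites up to c. That weight is controlled by vectors f_j which do not move with a, and it tends to 0.
-/
theorem tendsto_switchSum_edgeSgn {Λ : ℤ → ℝ} (hΛ : IsSwitch Λ)
    (h0 : ∀ ψ, M.H ψ = 0 → ψ = 0) :
    Tendsto (fun a => switchSum Λ (M.edgeSgn a)) atTop
      (𝓝 (2 * Module.finrank ℂ (M.zeroModes 0))) := by
  obtain ⟨c, -, hc, -⟩ := exists_eq_of_isSwitch hΛ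
  obtain ⟨L, hL⟩ := exists_abs_le_of_isSwitch hΛ
  set f := fun j => edgeInclusion N c (M.zeroBasis c j : Dimer (Ell (Set.Iic c) N)) with hf
  have hfn : ∀ j, ‖f j‖ = 1 := fun j => by
    rw [hf]; exact (norm_edgeInclusion_apply c _).trans (M.norm_zeroBasis c j)
  have hlim : Tendsto (fun a => 2 * ((1 + L) * ∑ j, (1 - ‖M.edgeSgn a (f j)‖ ^ 2))) atTop
      (𝓝 (2 * ((1 + L) * ∑ j, (1 - ‖M.sgnH (f j)‖ ^ 2)))) :=
    ((tendsto_finsetSum _ fun j _ =>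
      (((M.tendsto_edgeSgn h0 (f j)).norm.pow 2).const_sub 1)).const_mul _).const_mul _
  -- Without bulk zero modes Σ is isometric, so no f_j retains weight on the kernels in the limit.
  have hone : ∀ j, ‖M.sgnH (f j)‖ ^ 2 = 1 := fun j => by
    have hT : IsSelfAdjoint M.H := chiralHamiltonian_isSelfAdjoint _
    have h := norm_spectralProjection_zero_sq hT (f j)
    rw [spectralProjection_zero_apply hT, borelCalculus_sign_sign hT h0, sub_self, hfn] at h
    simp only [norm_zero] at h
    rw [sgnH]
    linarith
  simp only [hone, sub_self, Finset.sum_const_zero, mul_zero] at hlim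
  rw [tendsto_iff_norm_sub_tendsto_zero]
  refine squeeze_zero' (.of_forall fun a => norm_nonneg _) ?_ hlim
  filter_upwards [eventually_ge_atTop c] with a ha
  have hz : ∀ p, 0 ≤ M.zeroDensity a p := fun p => by rw [zeroDensity]; positivity
  have hs := M.hasSum_zeroDensity a
  rw [M.finrank_zeroModes_eq a 0] at hs
  have hs2 : Summable fun p => Λ p.1 * M.zeroDensity a p := by
    refine Summable.of_norm_bounded (hs.summable.mul_left L) fun p => ?_
    rw [norm_mul, Real.norm_eq_abs, Real.norm_of_nonneg (hz p)]
    exact mul_le_mul_of_nonneg_right (hL _) (hz p)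
  have hd : switchSum Λ (M.edgeSgn a) - 2 * Module.finrank ℂ (M.zeroModes 0) =
      2 * ∑' p, (Λ p.1 * M.zeroDensity a p - M.zeroDensity a p) := by
    rw [hs2.tsum_sub hs.summable, hs.tsum_eq, M.switchSum_edgeSgn hΛ]
    ring
  have ht := M.hasSum_zeroDensity_truncate ha
  rw [hd, norm_mul, Real.norm_of_nonneg zero_le_two]
  gcongr
  calc ‖∑' p, (Λ p.1 * M.zeroDensity a p - M.zeroDensity a p)‖
      ≤ (1 + L) * ∑ j, ‖spectralProjection (M.edgeH a) {0} (edgeRestriction N a (f j))‖ ^ 2 := by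
        refine tsum_of_norm_bounded (ht.mul_left (1 + L)) fun p => ?_
        by_cases hp : p.1 ≤ c
        · rw [if_pos hp, ← sub_one_mul, norm_mul, Real.norm_of_nonneg (hz p)]
          refine mul_le_mul_of_nonneg_right ?_ (hz p)
          refine (norm_sub_le _ _).trans ?_
          rw [norm_one, Real.norm_eq_abs]
          linarith [hL p.1]
        · rw [if_neg hp, hc p.1 (by omega)]
          simp
    _ ≤ (1 + L) * ∑ j, (1 - ‖M.edgeSgn a (f j)‖ ^ 2) := by
        have hL0 : 0 ≤ L := (abs_nonneg _).trans (hL 0)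
        gcongr with j
        rw [norm_spectralProjection_zero_sq (M.isSelfAdjoint_edgeH a), norm_edgeSgn_apply]
        gcongr
        have h := (edgeRestriction N a).le_of_opNorm_le (norm_edgeRestriction_le a) (f j)
        rw [hfn, mul_one] at h
        exact pow_le_one₀ (norm_nonneg _) h

/-- Bulk-edge duality, with the value of the indices. -/
theorem isTraceClass_bulkOp_and_bulkIndex (hgap : M.MobilityGap)
    (h0 : ∀ ψ, M.H ψ = 0 → ψ = 0) {Λ : ℤ → ℝ} (hΛ : IsSwitch Λ) :
    IsTraceClass (M.bulkOp hΛ) ∧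
      M.bulkIndex hΛ = Module.finrank ℂ (M.zeroModes 0) := by
  obtain ⟨μ, ν, hμ, hν, C, hbulk, hedge⟩ := hgap
  obtain ⟨B, hB, hBle⟩ := exists_summable_bound N hΛ hμ hν C
  -- The gap constants are common to all edges, so the majorant is independent of a; entries beyond
  -- the edge vanish.
  have hle : ∀ a p q, |Λ p.1 - Λ q.1| * ‖⟪siteVec p, M.edgeSgn a (siteVec q)⟫_ℂ‖ ≤ B (p, q) := by
    intro a p q
    refine hBle p q _ ?_
    have hpos : 0 ≤ 2 * (max C 0 * ((1 + |(p.1 : ℝ)|) ^ ν *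
        Real.exp (-(μ * |(p.1 : ℝ) - q.1|)))) := by positivity
    have h1 : ⟪siteVec p, M.edgeSgn a (siteVec q)⟫_ℂ = ⟪edgeRestriction N a (siteVec p),
        borelCalculus (M.edgeH a) Real.sign (edgeRestriction N a (siteVec q))⟫_ℂ :=
      (inner_edgeRestriction_left a _ _).symm
    rw [h1]
    by_cases hp : p.1 ≤ a
    · by_cases hq : q.1 ≤ a
      · rw [edgeRestriction_siteVec hp, edgeRestriction_siteVec hq]
        exact norm_inner_sign_le (hedge a) _ _
      · rw [edgeRestriction_siteVec_of_lt (not_le.1 hq), map_zero, inner_zero_right, norm_zero]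
        exact hpos
    · rw [edgeRestriction_siteVec_of_lt (not_le.1 hp), inner_zero_left, norm_zero]
      exact hpos
  have hsum : Summable fun r : (ℤ × Bool × Fin N) × (ℤ × Bool × Fin N) =>
      |Λ r.1.1 - Λ r.2.1| * ‖⟪siteVec r.1, M.sgnH (siteVec r.2)⟫_ℂ‖ :=
    Summable.of_nonneg_of_le (fun r => by positivity)
      (fun r => hBle r.1 r.2 _ (norm_inner_sign_le hbulk r.1 r.2)) hB
  obtain ⟨h1, h2⟩ := isTraceClass_and_trace_eq_switchSum hΛ (D := M.sgnH)
    (inner_borelCalculus_sign_left _) hsum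
  refine ⟨h1, ?_⟩
  -- The same sequence of edge sums tends to the bulk sum and to twice the number of zero modes.
  have h3 := tendsto_nhds_unique
    (tendsto_switchSum hB M.norm_edgeSgn_le hle (M.tendsto_edgeSgn h0))
    (M.tendsto_switchSum_edgeSgn hΛ h0)
  rw [bulkIndex, bulkOp, h2, h3]
  push_cast
  ring

end ChiralChain
end Duality

end ChiralDuality

theorem theorem2p1 (N : ℕ) (M : ChiralChain N) (hgap : M.MobilityGap)
    (hzero : ¬ Module.End.HasEigenvalue (M.H : Module.End ℂ (Dimer (Ell ℤ N))) 0)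
    (Λ : ℤ → ℝ) (hΛ : IsSwitch Λ) :
    IsTraceClass (M.bulkOp hΛ) ∧
    (∀ a : ℤ, IsTraceClass (M.edgeOp a) ∧ M.bulkIndex hΛ = M.edgeIndex a) ∧
    ∃ k : ℤ, M.bulkIndex hΛ = k := by
  have h0 : ∀ ψ, M.H ψ = 0 → ψ = 0 := by
    intro ψ hψ
    by_contra hne
    exact hzero (Module.End.hasEigenvalue_of_hasEigenvector
      ⟨Module.End.mem_eigenspace_iff.2 (by rw [zero_smul]; exact hψ), hne⟩)
  obtain ⟨h1, h2⟩ := M.isTraceClass_bulkOp_and_bulkIndex hgap h0 hΛ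
  refine ⟨h1, fun a => ?_, (Module.finrank ℂ (M.zeroModes 0) : ℤ), by rw [h2]; norm_cast⟩
  obtain ⟨h3, h4⟩ := M.isTraceClass_edgeOp_and_edgeIndex a
  exact ⟨h3, by rw [h2, h4, M.finrank_zeroModes_eq 0 a]⟩
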